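/- **Setting.** Let $\mathcal M$ be the set of ground terms (messages) over a signature of function symbols and fresh and public names, $=_E$ equality modulo an equational theory $E$, and $\gamma$ a surjective, $=_E$-respecting homomorphism from $\mathcal M$ to an algebra of bytestrings. For a set $R$ of multiset rewriting (MSR) rules $\ell\xrightarrow{a}r$ over linear and persistent facts, the induced labelled transition system (LTS) starts in the empty multiset and has a step $S\xrightarrow{a'}S\setminus\ell'_{\mathrm{lin}}\cup r'$ whenever $(\ell',a',r')=_E(\ell,a,r)\theta$ for a rule and a ground instantiation $\theta$ respecting variable sorts, and $M(\ell',S)$ holds: the linear facts $\ell'_{\mathrm{lin}}$ of $\ell'$ form a sub-multiset of $S$ and its persistent facts occur in $S$. $\mathrm{Tr}_t$ denotes the set of traces from which empty labels are removed and in which no action fact $\mathrm{Fr}(m)$ occurs at two different positions. **Protocol.** Fact symbols are partitioned into action, environment and role-$i$ state symbols ($1\le i\le n$); among the environment symbols there are disjoint sets of input and output symbols, with an input symbol $\mathrm{Setup}_i$ for each $i$. The model is $R=R_{env}\cup\bigcup_i R_i$, a finite set of rules such that: labels contain only action facts; environment rules contain only environment facts besides; an environment rule producing $\mathrm{Setup}_i$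 produces only this fact, has an empty label, and the first argument of the fact is a variable $rid$ of sort fresh; rules in $R_i$ consume only input facts and state facts of $i$, produce only output facts and state facts of $i$, and at least one state fact; and there is $k_i\ge1$ such that, in each rule of $R_i$, all state facts and $\mathrm{Setup}_i$ facts have the same first $k_i$ arguments, the first of which is a variable $rid$ of sort fresh (the thread identifier). Boolean combinations of equalities modulo $E$ may be attached to action symbols (equality restrictions); $\Phi(a)$ says that those attached to the facts of $a$ hold, and $\mathsf R_{eq}$ is the set of traces all of whose labels satisfy $\Phi$. **Components.** $R'_i$ arises from $R_i$ by replacing each fact $F(\vec t)$, $F$ an output symbol or a non-setup input symbol, by a buffered copy $F_i(rid,\vec t)$. The interface rules of role $i$ are $[F(\vec x)]\to[F_i(rid,\vec x)]$ for non-setup inputs, $[G_i(rid,\vec x)]\to[G(\vec x)]$ for outputs, and the environment rules $\ell\to[\mathrm{Setup}_i(\ldots)]$. Each is split into an environment half $\ell\to\emptyset$ or $\emptyset\to r$ (the part over the original facts; the premises of a setup rule) and a role half (the part over buffered facts; the conclusion of a setup rule), both labelled by a synchronization label $\lambda(rid,\vec x)$ that identifies the role and the rule and lists its variables. $R^e_{env}$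 consists of the non-setup rules of $R_{env}$ and the environment halves. **Specification.** $\psi_i(rid)=\exists p.\ \mathrm{token}(p)\star P_i(p,rid,\emptyset)$, where $P_i(p,rid,S)$ is the co-recursive (greatest) predicate that is the separating conjunction of: for each $R=(\ell\xrightarrow{a}r)\in R'_i$ with thread identifier instantiated by $rid$: $\forall\vec x,\ell',a',r'.\ M(\ell',S)\wedge(\ell',a',r')=_E(\ell,a,r)\wedge\Phi(a')\Rightarrow\exists p'.\ \mathrm{perm}_R(p,\vec x,\ell',a',r',p')\star P_i(p',rid,S\setminus\ell'_{\mathrm{lin}}\cup r')$; for each output $G$: $\forall\vec x.\ G_i(rid,\vec x)\in S\Rightarrow\exists p'.\ \mathrm{perm}_G(p,rid,\vec x,p')\star P_i(p',rid,S')$, where $S'$ is $S$ with one copy of $G_i(rid,\vec x)$ removed if $G$ is linear, and $S'=S$ otherwise; for each input or setup rule with role half $\emptyset\to[F']$: $\exists p',\vec z.\ \mathrm{perm}(p,rid,\vec z,p')\star P_i(p',rid,S\cup[F'(rid,\vec z)])$. Heaps are multisets of token and permission predicates. A heap step consumes a permission whose source place carries a token and moves the token to the target place; if the environment returns values other than those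 in the permission, the heap puts no further constraint. $\mathrm{Tr}(\phi)$ is the set of label sequences possible in every heap satisfying $\phi$. **Concrete system.** Programs $c$ have LTSs $\mathscr C$ whose labels are internal operations $\mathrm{perm}_R(\vec x,\ell',a',r')$ and concrete I/O operations $\mathrm{perm}_\lambda(rid,\vec b,\vec x)$ with bytestrings $\vec b$ and ghost messages $\vec x$. The partial map $\pi'_{ext}$ sends $\mathrm{perm}_\lambda(rid,\vec b,\vec x)$ to $\mathrm{perm}_\lambda(rid,\vec x)$ if $\vec b=\gamma(\vec x)$ (otherwise it is undefined); $\pi_{ext}$ sends $\mathrm{perm}_\lambda(rid,\vec x)$ to $[\lambda(rid,\vec x)]$; $\pi_{int}$ sends $\mathrm{perm}_R(\vec x,\ell',a',r')$ to $a'$; all are the identity elsewhere. The concrete environment $\mathscr E$ is the LTS of $R^e_{env}$ with each label $[\lambda(rid,\vec x)]$ renamed to $\mathrm{perm}_\lambda(rid,\gamma(\vec x),\vec x)$; $\mathscr E_{eq}$ is the same with only those steps whose label satisfies $\Phi$. $\Lambda'$ is the preimage under $\pi_{ext}\circ\pi'_{ext}$ of the labels $=_E$-equal to ground instances of synchronization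 labels. $|||$ interleaves a family of LTSs; $\|_{\Lambda'}$ synchronizes equal labels in $\Lambda'$, with resulting label $\emptyset$, and interleaves all other labels. **Theorem (Soundness).** Let $\vdash_\alpha\{\phi\}\,c\,\{\mathsf{true}\}$ be a verification judgement such that, for all partial label maps $\alpha$, specifications $\phi$ and programs $c$, derivability of $\vdash_\alpha\{\phi\}\,c\,\{\mathsf{true}\}$ implies that $\alpha$ is defined on all labels in traces of $\mathscr C$ and $\alpha(\mathrm{Tr}(\mathscr C))\subseteq\mathrm{Tr}(\phi)$. Suppose that $\vdash_{\pi'_{ext}}\{\psi_i(rid)\}\,c_i(rid)\,\{\mathsf{true}\}$ for each role $i$ and fresh name $rid$. Then $$\mathrm{Tr}_t\Big(\big(|||_{i,rid}\,\pi_{int}(\mathscr C_i(rid))\big)\,\|_{\Lambda'}\,\mathscr E\Big)\subseteq\mathrm{Tr}_t(R)$$ and, for the semantics with equality restrictions, $$\mathrm{Tr}_t\Big(\big(|||_{i,rid}\,\pi_{int}(\mathscr C_i(rid))\big)\,\|_{\Lambda'}\,\mathscr E_{eq}\Big)\subseteq\mathrm{Tr}_t(R)\cap\mathsf R_{eq}.$$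 -/

import Mathlib

namespace ProtoImpl

/-! ## Terms, equational theories, bytestring algebras -/

/-- A term signature: function symbols with arities, fresh names and public names. -/
structure TermSig where
  Fun : Type
  ar : Fun → ℕ
  Fresh : Type
  Pub : Type

/-- Terms over the signature `S` with variables in `V`. -/
inductive Term (S : TermSig) (V : Type) : Type
  | fresh (a : S.Fresh) : Term S V
  | pub (a : S.Pub) : Term S V
  | var (x : V) : Term S V
  | app (f : S.Fun) (ts : Fin (S.ar f) → Term S V) : Term S V

/-- Messages are ground terms. -/
abbrev Msg (S : TermSig) : Type := Term S Empty

def Term.subst {S : TermSig} {V W : Type} (θ : V → Term S W) : Term S V → Term S W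
  | .fresh a => .fresh a
  | .pub a => .pub a
  | .var x => θ x
  | .app f ts => .app f (fun j => (ts j).subst θ)

/-- A set of equations between terms (with variables numbered by `ℕ`). -/
abbrev EqTheory (S : TermSig) : Type := Set (Term S ℕ × Term S ℕ)

/-- Equality modulo `E`: the least equivalence relation that contains all substitution instances
of the equations and is closed under contexts. -/
inductive EqMod {S : TermSig} (E : EqTheory S) {V : Type} : Term S V → Term S V → Prop
  | ax {l r : Term S ℕ} (h : (l, r) ∈ E) (σ : ℕ → Term S V) : EqMod E (l.subst σ) (r.subst σ)
  | refl (t : Term S V) : EqMod E t t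
  | symm {t u : Term S V} : EqMod E t u → EqMod E u t
  | trans {t u v : Term S V} : EqMod E t u → EqMod E u v → EqMod E t v
  | app (f : S.Fun) {ts us : Fin (S.ar f) → Term S V} :
      (∀ j, EqMod E (ts j) (us j)) → EqMod E (.app f ts) (.app f us)

/-- A `Σ`-algebra on a set of bytestrings, with an interpretation of the names. -/
structure ByteAlg (S : TermSig) where
  Carrier : Type
  fresh : S.Fresh → Carrier
  pub : S.Pub → Carrier
  app : (f : S.Fun) → (Fin (S.ar f) → Carrier) → Carrier

/-- The concretization function `γ` from messages to bytestrings: the homomorphism that is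
determined by the interpretation of names and function symbols. -/
def ByteAlg.γ {S : TermSig} (A : ByteAlg S) : Msg S → A.Carrier
  | .fresh a => A.fresh a
  | .pub a => A.pub a
  | .var x => x.elim
  | .app f ts => A.app f (fun j => A.γ (ts j))

/-- `γ` preserves equality modulo `E`, and every bytestring represents some message. -/
structure ByteAlg.Concretizes {S : TermSig} (A : ByteAlg S) (E : EqTheory S) : Prop where
  resp : ∀ t u : Msg S, EqMod E t u → A.γ t = A.γ u
  surj : Function.Surjective A.γ

/-! ## Facts and multiset rewriting -/

/-- A signature of fact symbols; a symbol that is not persistent is linear. -/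
structure FactSig where
  Sym : Type
  arity : Sym → ℕ
  persistent : Sym → Prop

structure Fact (S : TermSig) (F : FactSig) (V : Type) where
  sym : F.Sym
  args : Fin (F.arity sym) → Term S V

abbrev GFact (S : TermSig) (F : FactSig) : Type := Fact S F Empty

def Fact.subst {S : TermSig} {F : FactSig} {V W : Type} (θ : V → Term S W) (g : Fact S F V) :
    Fact S F W :=
  ⟨g.sym, fun j => (g.args j).subst θ⟩

inductive Fact.EqMod {S : TermSig} {F : FactSig} (E : EqTheory S) {V : Type} :
    Fact S F V → Fact S F V → Prop
  | mk (f : F.Sym) {ts us : Fin (F.arity f) → Term S V} (h : ∀ j, ProtoImpl.EqMod E (ts j) (us j)) :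
      Fact.EqMod E ⟨f, ts⟩ ⟨f, us⟩

/-- Equality modulo `E` of multisets of facts. -/
def MEq {S : TermSig} {F : FactSig} (E : EqTheory S) {V : Type} :
    Multiset (Fact S F V) → Multiset (Fact S F V) → Prop :=
  Multiset.Rel (Fact.EqMod E)

/-- The sort of a rule variable: arbitrary messages, fresh names, or public names. -/
inductive VSort
  | msg
  | fresh
  | pub

def VSort.Holds {S : TermSig} : VSort → Msg S → Prop
  | .msg, _ => True
  | .fresh, t => ∃ a, t = .fresh a
  | .pub, t => ∃ a, t = .pub a

/-- A rewrite rule `lhs —[act]→ rhs` whose variables are `x_0, …, x_{nvars-1}`. -/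
structure Rule (S : TermSig) (F : FactSig) where
  nvars : ℕ
  sort : Fin nvars → VSort
  lhs : Multiset (Fact S F (Fin nvars))
  act : Multiset (Fact S F (Fin nvars))
  rhs : Multiset (Fact S F (Fin nvars))

/-- `x` is an instantiation of the rule's variables with messages of the right sorts. -/
def Rule.Sorted {S : TermSig} {F : FactSig} (r : Rule S F) (x : Fin r.nvars → Msg S) : Prop :=
  ∀ j, (r.sort j).Holds (x j)

/-- `l —[a]→ r` is, modulo `E`, the instance of the rule under `x`. -/
def Rule.InstMod {S : TermSig} {F : FactSig} (E : EqTheory S) (R : Rule S F)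
    (x : Fin R.nvars → Msg S) (l a r : Multiset (GFact S F)) : Prop :=
  MEq E l (R.lhs.map (Fact.subst x)) ∧ MEq E a (R.act.map (Fact.subst x)) ∧
    MEq E r (R.rhs.map (Fact.subst x))

open Classical in
/-- The linear facts of a multiset. -/
noncomputable def linPart {S : TermSig} {F : FactSig} (m : Multiset (GFact S F)) :
    Multiset (GFact S F) :=
  m.filter (fun g => ¬ F.persistent g.sym)

/-- The matching condition `M(l, s)`. -/
def Matches {S : TermSig} {F : FactSig} (l s : Multiset (GFact S F)) : Prop :=
  linPart l ≤ s ∧ ∀ g ∈ l, F.persistent g.sym → g ∈ s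

open Classical in
/-- The updated state `U(l, r, s)`. -/
noncomputable def update {S : TermSig} {F : FactSig} (l r s : Multiset (GFact S F)) :
    Multiset (GFact S F) :=
  s - linPart l + r

/-! ## Labelled transition systems -/

structure LTS (L : Type) where
  State : Type
  start : State
  step : State → L → State → Prop

/-- `A.Run s τ s'`: from `s`, the system reaches `s'` performing the labels `τ`. -/
inductive LTS.Run {L : Type} (A : LTS L) : A.State → List L → A.State → Prop
  | nil (s : A.State) : LTS.Run A s [] s
  | cons {s s' s'' : A.State} {a : L} {τ : List L} :
      A.step s a s' → LTS.Run A s' τ s'' → LTS.Run A s (a :: τ) s''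

/-- The set `Tr(A)` of (finite) traces. -/
def LTS.traces {L : Type} (A : LTS L) : Set (List L) := {τ | ∃ s, A.Run A.start τ s}

def LTS.relabel {L L' : Type} (A : LTS L) (f : L → L') : LTS L' where
  State := A.State
  start := A.start
  step s b s' := ∃ a, f a = b ∧ A.step s a s'

open Classical in
/-- The interleaving parallel composition of a family of systems. -/
noncomputable def LTS.interleave {L ι : Type} (A : ι → LTS L) : LTS L where
  State := ∀ j, (A j).State
  start := fun j => (A j).start
  step s a s' := ∃ (j : ι) (t : (A j).State), (A j).step (s j) a t ∧ s' = Function.update s j t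

/-- The synchronizing parallel composition on the labels in `Λ`; a synchronized step has
the label `ε`. -/
def LTS.sync {L : Type} (A : LTS L) (Λ : Set L) (ε : L) (B : LTS L) : LTS L where
  State := A.State × B.State
  start := (A.start, B.start)
  step s a s' :=
    (a = ε ∧ ∃ a' ∈ Λ, A.step s.1 a' s'.1 ∧ B.step s.2 a' s'.2) ∨
    (a ∉ Λ ∧ A.step s.1 a s'.1 ∧ s'.2 = s.2) ∨
    (a ∉ Λ ∧ B.step s.2 a s'.2 ∧ s'.1 = s.1)

/-- The transition system induced by a set of rewrite rules. The predicate `ok` is a check on the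
actions of every step; with `fun _ => True` this is the usual semantics. -/
noncomputable def msrLTS {S : TermSig} {F : FactSig} (E : EqTheory S)
    (ok : Multiset (GFact S F) → Prop) (Rs : Set (Rule S F)) : LTS (Multiset (GFact S F)) where
  State := Multiset (GFact S F)
  start := 0
  step s a s' := ∃ R ∈ Rs, ∃ (x : Fin R.nvars → Msg S) (l r : Multiset (GFact S F)),
    R.Sorted x ∧ R.InstMod E x l a r ∧ ok a ∧ Matches l s ∧ s' = update l r s

/-! ## Protocol models -/

/-- The parts of the fact signature of an `n`-role protocol: action facts, environment facts
that are neither input nor output facts, input facts, output facts, state facts of a role. -/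
inductive FactKind (n : ℕ)
  | act
  | env
  | inp
  | out
  | state (i : Fin n)

/-- The fact signature of an `n`-role protocol, with an initialization symbol `setup i` for each
role and the action symbol `fr` that records the generation of fresh names. -/
structure ProtoSig (n : ℕ) extends FactSig where
  kind : Sym → FactKind n
  setup : Fin n → Sym
  setup_kind : ∀ i, kind (setup i) = .inp
  fr : Sym
  fr_kind : kind fr = .act
  fr_arity : arity fr = 1

/-- A rule together with one of its variables, its thread identifier. -/
structure RidRule (S : TermSig) (F : FactSig) extends Rule S F where
  rid : Fin nvars

/-- An `n`-role protocol model: the environment rules, which comprise those of the attacker (message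
deduction), of fresh name generation and of role setup, and the rules of each role. The environment
rules are arbitrary up to the format requirements below. -/
structure Protocol {n : ℕ} (S : TermSig) (F : ProtoSig n) where
  env : Set (Rule S F.toFactSig)
  role : Fin n → Set (RidRule S F.toFactSig)

/-- The first argument of the fact `g` is `t`. -/
def Fact.FirstArg {S : TermSig} {F : FactSig} {V : Type} (g : Fact S F V) (t : Term S V) : Prop :=
  ∃ h : 0 < F.arity g.sym, g.args ⟨0, h⟩ = t

/-- The format requirements on protocol models. -/
structure Protocol.WellFormed {n : ℕ} {S : TermSig} {F : ProtoSig n} (P : Protocol S F) : Prop where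
  env_finite : P.env.Finite
  role_finite : ∀ i, (P.role i).Finite
  env_act : ∀ r ∈ P.env, ∀ g ∈ r.act, F.kind g.sym = .act
  env_facts : ∀ r ∈ P.env, ∀ g ∈ r.lhs + r.rhs,
    F.kind g.sym = .env ∨ F.kind g.sym = .inp ∨ F.kind g.sym = .out
  /-- an environment rule that produces a setup fact produces nothing else, has an empty label, and
  the first argument of the setup fact is a variable of sort `fresh` -/
  env_setup : ∀ r ∈ P.env, ∀ i, ∀ g ∈ r.rhs, g.sym = F.setup i →
    r.act = 0 ∧ r.rhs = {g} ∧ ∃ v, r.sort v = .fresh ∧ g.FirstArg (.var v)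
  role_act : ∀ i, ∀ R ∈ P.role i, ∀ g ∈ R.act, F.kind g.sym = .act
  role_lhs : ∀ i, ∀ R ∈ P.role i, ∀ g ∈ R.lhs, F.kind g.sym = .state i ∨ F.kind g.sym = .inp
  role_rhs : ∀ i, ∀ R ∈ P.role i, ∀ g ∈ R.rhs, F.kind g.sym = .state i ∨ F.kind g.sym = .out
  role_state : ∀ i, ∀ R ∈ P.role i, ∃ g ∈ R.rhs, F.kind g.sym = .state i
  role_rid : ∀ i, ∀ R ∈ P.role i, R.sort R.rid = .fresh
  /-- the first `k ≥ 1` arguments of all state and setup facts of a role's rule agree, and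
  the very first one is the thread identifier -/
  role_init : ∀ i, ∃ k : ℕ, 1 ≤ k ∧ ∀ R ∈ P.role i, ∃ param : ℕ → Term S (Fin R.nvars),
    param 0 = .var R.rid ∧
    ∀ g ∈ R.lhs + R.rhs, (F.kind g.sym = .state i ∨ g.sym = F.setup i) →
      k ≤ F.arity g.sym ∧ ∀ j : Fin (F.arity g.sym), j.val < k → g.args j = param j.val

/-- The whole multiset rewriting system of the model. -/
def Protocol.rules {n : ℕ} {S : TermSig} {F : ProtoSig n} (P : Protocol S F) :
    Set (Rule S F.toFactSig) :=
  P.env ∪ {r | ∃ i, ∃ R ∈ P.role i, R.toRule = r}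

/-! ## Interface between roles and environment -/

/-- The interface rules of a role: receiving an input fact `f`, emitting an output fact `f`,
or performing a setup rule. -/
inductive Iface (S : TermSig) (F : FactSig)
  | inp (f : F.Sym)
  | out (f : F.Sym)
  | setup (r : RidRule S F)

/-- The number of variables of an interface rule. -/
def Iface.nvars {S : TermSig} {F : FactSig} : Iface S F → ℕ
  | .inp f => F.arity f + 1
  | .out f => F.arity f + 1
  | .setup r => r.nvars

/-- The thread identifier variable of an interface rule. -/
def Iface.rid {S : TermSig} {F : FactSig} : (k : Iface S F) → Fin k.nvars
  | .inp f => (0 : Fin (F.arity f + 1))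
  | .out f => (0 : Fin (F.arity f + 1))
  | .setup r => r.rid

def Iface.IsOutput {S : TermSig} {F : FactSig} : Iface S F → Prop
  | .out _ => True
  | _ => False

/-- The fact symbols of the component models: the given ones, the buffered copy `F_i` of a symbol
for each role `i`, and a synchronization label for each role and interface rule. -/
inductive XSym (S : TermSig) (F : FactSig) (n : ℕ)
  | base (f : F.Sym)
  | buf (i : Fin n) (f : F.Sym)
  | lab (i : Fin n) (k : Iface S F)

def XSym.arity {S : TermSig} {F : FactSig} {n : ℕ} : XSym S F n → ℕ
  | .base f => F.arity f
  | .buf _ f => F.arity f + 1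
  | .lab _ k => k.nvars

def XSym.Persistent {S : TermSig} {F : FactSig} {n : ℕ} : XSym S F n → Prop
  | .base f => F.persistent f
  | .buf _ f => F.persistent f
  | .lab _ _ => False

abbrev XSig (S : TermSig) (F : FactSig) (n : ℕ) : FactSig where
  Sym := XSym S F n
  arity := XSym.arity
  persistent := XSym.Persistent

abbrev XFact (S : TermSig) (F : FactSig) (n : ℕ) (V : Type) : Type := Fact S (XSig S F n) V

def baseFact {S : TermSig} {F : FactSig} (n : ℕ) {V : Type} (g : Fact S F V) : XFact S F n V :=
  ⟨XSym.base g.sym, g.args⟩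

/-- The buffered fact `f_i(t, ts)`. -/
def bufFact {S : TermSig} {F : FactSig} {n : ℕ} {V : Type} (i : Fin n) (f : F.Sym) (t : Term S V)
    (ts : Fin (F.arity f) → Term S V) : XFact S F n V :=
  ⟨XSym.buf i f, (Fin.cons t ts : Fin (F.arity f + 1) → Term S V)⟩

/-- The synchronization label `λ_k(x)` of role `i`. -/
def labFact {S : TermSig} {F : FactSig} {n : ℕ} {V : Type} (i : Fin n) (k : Iface S F)
    (x : Fin k.nvars → Term S V) : XFact S F n V :=
  ⟨XSym.lab i k, x⟩

/-- The symbols that get buffered: output symbols, and input symbols other than setup symbols. -/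
def ProtoSig.Buffered {n : ℕ} (F : ProtoSig n) (f : F.Sym) : Prop :=
  (F.kind f = .inp ∧ ∀ i, f ≠ F.setup i) ∨ F.kind f = .out

open Classical in
/-- Replace `f(ts)` by `f_i(rid, ts)` if `f` is buffered. -/
noncomputable def ProtoSig.bufferize {n : ℕ} {S : TermSig} (F : ProtoSig n) (i : Fin n) {V : Type}
    (rid : Term S V) (g : Fact S F.toFactSig V) : XFact S F.toFactSig n V :=
  if F.Buffered g.sym then bufFact i g.sym rid g.args else baseFact n g

/-- The role rule with input and output facts replaced by their buffered versions. -/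
noncomputable def ProtoSig.bufferRule {n : ℕ} {S : TermSig} (F : ProtoSig n) (i : Fin n)
    (R : RidRule S F.toFactSig) : Rule S (XSig S F.toFactSig n) where
  nvars := R.nvars
  sort := R.sort
  lhs := R.lhs.map (F.bufferize i (.var R.rid))
  act := R.act.map (baseFact n)
  rhs := R.rhs.map (F.bufferize i (.var R.rid))

/-- An environment rule, seen as a rule over the signature of the component models. -/
def baseRule {S : TermSig} {F : FactSig} (n : ℕ) (r : Rule S F) : Rule S (XSig S F n) where
  nvars := r.nvars
  sort := r.sort
  lhs := r.lhs.map (baseFact n)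
  act := r.act.map (baseFact n)
  rhs := r.rhs.map (baseFact n)

/-- The interface rules of role `i` in the model. -/
def Protocol.HasIface {n : ℕ} {S : TermSig} {F : ProtoSig n} (P : Protocol S F) (i : Fin n) :
    Iface S F.toFactSig → Prop
  | .inp f => F.kind f = .inp ∧ ∀ j, f ≠ F.setup j
  | .out f => F.kind f = .out
  | .setup r => r.toRule ∈ P.env ∧
      ∃ g : Fact S F.toFactSig (Fin r.nvars), g.sym = F.setup i ∧ r.rhs = {g} ∧
        g.FirstArg (.var r.rid)

/-- The sorts of the variables of the interface rules for an input or output symbol: the first one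
is the thread identifier. -/
def ridSort (m : ℕ) : Fin (m + 1) → VSort := Fin.cons .fresh (fun _ => .msg)

/-- The variables `x_1, …, x_m`, which follow the thread identifier `x_0`. -/
def restVars {S : TermSig} {m : ℕ} : Fin m → Term S (Fin (m + 1)) := fun j => .var j.succ

/-- The half of an interface rule that belongs to role `i`. -/
def roleHalf {S : TermSig} {F : FactSig} {n : ℕ} (i : Fin n) :
    (k : Iface S F) → Rule S (XSig S F n)
  | .inp f =>
      { nvars := F.arity f + 1, sort := ridSort (F.arity f)
        lhs := 0
        act := {labFact i (.inp f) (fun j => .var j)}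
        rhs := {bufFact i f (.var 0) restVars} }
  | .out f =>
      { nvars := F.arity f + 1, sort := ridSort (F.arity f)
        lhs := {bufFact i f (.var 0) restVars}
        act := {labFact i (.out f) (fun j => .var j)}
        rhs := 0 }
  | .setup r =>
      { nvars := r.nvars, sort := r.sort
        lhs := 0
        act := {labFact i (.setup r) (fun j => .var j)}
        rhs := r.rhs.map (baseFact n) }

/-- The half of an interface rule of role `i` that belongs to the environment. -/
def envHalf {S : TermSig} {F : FactSig} {n : ℕ} (i : Fin n) :
    (k : Iface S F) → Rule S (XSig S F n)
  | .inp f =>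
      { nvars := F.arity f + 1, sort := ridSort (F.arity f)
        lhs := {baseFact n ⟨f, restVars⟩}
        act := {labFact i (.inp f) (fun j => .var j)}
        rhs := 0 }
  | .out f =>
      { nvars := F.arity f + 1, sort := ridSort (F.arity f)
        lhs := 0
        act := {labFact i (.out f) (fun j => .var j)}
        rhs := {baseFact n ⟨f, restVars⟩} }
  | .setup r =>
      { nvars := r.nvars, sort := r.sort
        lhs := r.lhs.map (baseFact n)
        act := {labFact i (.setup r) (fun j => .var j)}
        rhs := 0 }

theorem roleHalf_nvars {S : TermSig} {F : FactSig} {n : ℕ} (i : Fin n) (k : Iface S F) :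
    (roleHalf i k).nvars = k.nvars := by
  cases k <;> rfl

/-- The instance of the premises of `roleHalf i k` under `x`. -/
def roleHalfLhs {S : TermSig} {F : FactSig} {n : ℕ} (i : Fin n) (k : Iface S F)
    (x : Fin k.nvars → Msg S) : Multiset (GFact S (XSig S F n)) :=
  (roleHalf i k).lhs.map (Fact.subst (fun j => x (j.cast (roleHalf_nvars i k))))

/-- The instance of the conclusions of `roleHalf i k` under `x`. -/
def roleHalfRhs {S : TermSig} {F : FactSig} {n : ℕ} (i : Fin n) (k : Iface S F)
    (x : Fin k.nvars → Msg S) : Multiset (GFact S (XSig S F n)) :=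
  (roleHalf i k).rhs.map (Fact.subst (fun j => x (j.cast (roleHalf_nvars i k))))

/-- The rules of the environment component: the environment rules other than the setup rules, and
the environment halves of the interface rules. -/
def Protocol.envRules {n : ℕ} {S : TermSig} {F : ProtoSig n} (P : Protocol S F) :
    Set (Rule S (XSig S F.toFactSig n)) :=
  {r | ∃ r₀ ∈ P.env, (∀ g ∈ r₀.rhs, ∀ i, g.sym ≠ F.setup i) ∧ r = baseRule n r₀} ∪
  {r | ∃ i k, P.HasIface i k ∧ r = envHalf i k}

/-! ## Equality restrictions -/

/-- Boolean combinations of equalities between the variables `x_0, …, x_{m-1}`. -/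
inductive EqFormula (m : ℕ)
  | eq (i j : Fin m)
  | neg (φ : EqFormula m)
  | conj (φ χ : EqFormula m)
  | disj (φ χ : EqFormula m)

def EqFormula.Holds {S : TermSig} (E : EqTheory S) {m : ℕ} (t : Fin m → Msg S) :
    EqFormula m → Prop
  | .eq i j => EqMod E (t i) (t j)
  | .neg φ => ¬ φ.Holds E t
  | .conj φ χ => φ.Holds E t ∧ χ.Holds E t
  | .disj φ χ => φ.Holds E t ∨ χ.Holds E t

/-- An assignment of formulas to some of the fact symbols (none: no restriction). -/
abbrev EqRestr {n : ℕ} (F : ProtoSig n) : Type := (f : F.Sym) → Option (EqFormula (F.arity f))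

/-- The equality checks that the action facts in `a` stand for are satisfied. -/
def EqRestr.Sat {n : ℕ} {S : TermSig} {F : ProtoSig n} (ρ : EqRestr F) (E : EqTheory S)
    (a : Multiset (GFact S (XSig S F.toFactSig n))) : Prop :=
  ∀ g : GFact S F.toFactSig, baseFact n g ∈ a → ∀ φ ∈ ρ g.sym, φ.Holds E g.args

/-! ## Labels -/

/-- Transition labels of all systems. -/
inductive Label (S : TermSig) (F : FactSig) (n : ℕ) (B : Type)
  /-- a multiset of action facts -/
  | acts (a : Multiset (GFact S (XSig S F n)))
  /-- the internal operation or permission for the protocol rule `R`, with the values of its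
  variables and the instances (modulo `E`) of its premises, label and conclusions -/
  | op (R : RidRule S F) (x : Fin R.nvars → Msg S) (l a r : Multiset (GFact S (XSig S F n)))
  /-- the permission for an interface rule -/
  | perm (i : Fin n) (k : Iface S F) (x : Fin k.nvars → Msg S)
  /-- the concrete operation for an interface rule, with a bytestring and a (ghost) message for
  each parameter except the thread identifier -/
  | cperm (i : Fin n) (k : Iface S F) (b : {j : Fin k.nvars // j ≠ k.rid} → B)
      (x : Fin k.nvars → Msg S)

/-- The relabeling `π_int`. -/
def piInt {S : TermSig} {F : FactSig} {n : ℕ} {B : Type} : Label S F n B → Label S F n B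
  | .op _ _ _ a _ => .acts a
  | ℓ => ℓ

/-- The relabeling `π_ext`. -/
def piExt {S : TermSig} {F : FactSig} {n : ℕ} {B : Type} : Label S F n B → Label S F n B
  | .perm i k x => .acts {labFact i k x}
  | ℓ => ℓ

open Classical in
/-- The partial relabeling `π'_ext`, which forgets bytestrings; it is defined only where
the bytestrings are the concretizations of the messages. -/
noncomputable def piExt' {S : TermSig} {F : FactSig} {n : ℕ} (A : ByteAlg S) :
    Label S F n A.Carrier → Option (Label S F n A.Carrier)
  | .cperm i k b x => if ∀ j, b j = A.γ (x j.val) then some (.perm i k x) else none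
  | ℓ => some ℓ

/-! ## Specifications in separation logic -/

section Spec

variable {S : TermSig} {F : FactSig} {n : ℕ} {B : Type}

/-- Places. Any set that is large enough to provide a new place after each operation would do;
here these are the sequences of labels. -/
abbrev Place (S : TermSig) (F : FactSig) (n : ℕ) (B : Type) : Type := List (Label S F n B)

/-- Ground token and permission predicates. -/
inductive Chunk (S : TermSig) (F : FactSig) (n : ℕ) (B : Type)
  | token (p : Place S F n B)
  | perm (p : Place S F n B) (ℓ : Label S F n B) (p' : Place S F n B)

/-- Heaps: (possibly infinite) multisets of ground token and permission predicates. -/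
abbrev Heap (S : TermSig) (F : FactSig) (n : ℕ) (B : Type) : Type := Chunk S F n B → ℕ

/-- Assertions, identified with their sets of heap models. -/
abbrev Assertion (S : TermSig) (F : FactSig) (n : ℕ) (B : Type) : Type := Heap S F n B → Prop

/-- The heap contains (at least) the chunk `c`. -/
def Assertion.chunk (c : Chunk S F n B) : Assertion S F n B := fun h => 1 ≤ h c

/-- Separating conjunction. -/
def Assertion.sep (φ χ : Assertion S F n B) : Assertion S F n B :=
  fun h => ∃ h₁ h₂, h₁ + h₂ ≤ h ∧ φ h₁ ∧ χ h₂

/-- Iterated separating conjunction: `h` contains pairwise separate parts, one for each index,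
that satisfy the conjuncts. -/
def Assertion.bigSep {ι : Type} (φ : ι → Assertion S F n B) : Assertion S F n B :=
  fun h => ∃ g : ι → Heap S F n B, (∀ s : Finset ι, ∑ j ∈ s, g j ≤ h) ∧ ∀ j, φ j (g j)

/-- Two labels of the same operation agree on the arguments that the caller provides, and hence
may differ only in the values returned by the environment. -/
inductive SameCall : Label S F n B → Label S F n B → Prop
  | refl (ℓ : Label S F n B) : SameCall ℓ ℓ
  | inp (i : Fin n) (k : Iface S F) (x y : Fin k.nvars → Msg S) :
      ¬ k.IsOutput → x k.rid = y k.rid → SameCall (.perm i k x) (.perm i k y)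

open Classical in
/-- One step of a heap; `none` is the heap state in which all behaviour is allowed. A token is moved
through a permission, which is consumed. If the environment returns other values than those
that the permission predicts, then this heap puts no further constraints. -/
inductive HeapStep : Option (Heap S F n B) → Label S F n B → Option (Heap S F n B) → Prop
  | move (h : Heap S F n B) (p p' : Place S F n B) (ℓ : Label S F n B) :
      HeapStep (some (h + Pi.single (Chunk.token p) 1 + Pi.single (Chunk.perm p ℓ p') 1)) ℓ
        (some (h + Pi.single (Chunk.token p') 1))
  | contradict (h : Heap S F n B) (p p' : Place S F n B) (ℓ ℓ' : Label S F n B) :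
      SameCall ℓ ℓ' → ℓ ≠ ℓ' →
      HeapStep (some (h + Pi.single (Chunk.token p) 1 + Pi.single (Chunk.perm p ℓ p') 1)) ℓ' none
  | chaos (ℓ : Label S F n B) : HeapStep none ℓ none

/-- The transition system of a heap. -/
def Heap.lts (h : Heap S F n B) : LTS (Label S F n B) where
  State := Option (Heap S F n B)
  start := some h
  step := HeapStep

/-- The traces of an assertion are those that are possible in all of its heap models. -/
def Assertion.traces (φ : Assertion S F n B) : Set (List (Label S F n B)) :=
  {τ | ∀ h, φ h → τ ∈ (Heap.lts h).traces}

end Spec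

section RoleSpec

variable {n : ℕ} {S : TermSig} {F : ProtoSig n}

/-- States of a role component. -/
abbrev RoleState (S : TermSig) (F : ProtoSig n) : Type :=
  Multiset (GFact S (XSig S F.toFactSig n))

/-- The conjunct `φ_R` for a protocol rule `R` of role `i`; `Q` stands for the co-recursive call. -/
def protoConj (B : Type) (E : EqTheory S) (ρ : EqRestr F) (i : Fin n) (rid : S.Fresh)
    (R : RidRule S F.toFactSig)
    (Q : Place S F.toFactSig n B → RoleState S F → Assertion S F.toFactSig n B)
    (p : Place S F.toFactSig n B) (s : RoleState S F) : Assertion S F.toFactSig n B :=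
  fun h => ∀ (x : Fin R.nvars → Msg S) (l a r : RoleState S F),
    x R.rid = .fresh rid → (F.bufferRule i R).Sorted x → (F.bufferRule i R).InstMod E x l a r →
    Matches l s → ρ.Sat E a →
    ∃ p', ((Assertion.chunk (.perm p (.op R x l a r) p')).sep (Q p' (update l r s))) h

/-- The conjunct for an interface rule of role `i`. Outputs of the role are universally
quantified, inputs are existentially quantified. -/
def ifaceConj (B : Type) (i : Fin n) (rid : S.Fresh) (k : Iface S F.toFactSig)
    (Q : Place S F.toFactSig n B → RoleState S F → Assertion S F.toFactSig n B)
    (p : Place S F.toFactSig n B) (s : RoleState S F) : Assertion S F.toFactSig n B :=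
  fun h =>
    (k.IsOutput → ∀ x : Fin k.nvars → Msg S, x k.rid = .fresh rid → Matches (roleHalfLhs i k x) s →
      ∃ p', ((Assertion.chunk (.perm p (.perm i k x) p')).sep
        (Q p' (update (roleHalfLhs i k x) 0 s))) h) ∧
    (¬ k.IsOutput → ∃ (p' : Place S F.toFactSig n B) (x : Fin k.nvars → Msg S),
      x k.rid = .fresh rid ∧
      ((Assertion.chunk (.perm p (.perm i k x) p')).sep (Q p' (s + roleHalfRhs i k x))) h)

/-- The body of the co-recursive definition of the role specification predicate. -/
def Protocol.roleBody (P : Protocol S F) (B : Type) (E : EqTheory S) (ρ : EqRestr F) (i : Fin n)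
    (rid : S.Fresh)
    (Q : Place S F.toFactSig n B → RoleState S F → Assertion S F.toFactSig n B)
    (p : Place S F.toFactSig n B) (s : RoleState S F) : Assertion S F.toFactSig n B :=
  (Assertion.bigSep fun R : P.role i => protoConj B E ρ i rid R.val Q p s).sep
    (Assertion.bigSep fun k : {k // P.HasIface i k} => ifaceConj B i rid k.val Q p s)

/-- The co-recursive predicate `P_i(p, rid, s)`: the greatest fixed point of the (monotone)
`roleBody`, as the union of all its post-fixed points. -/
def Protocol.rolePred (P : Protocol S F) (B : Type) (E : EqTheory S) (ρ : EqRestr F) (i : Fin n)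
    (rid : S.Fresh) (p : Place S F.toFactSig n B) (s : RoleState S F) :
    Assertion S F.toFactSig n B :=
  fun h => ∃ Q : Place S F.toFactSig n B → RoleState S F → Assertion S F.toFactSig n B,
    (∀ p' s' h', Q p' s' h' → P.roleBody B E ρ i rid Q p' s' h') ∧ Q p s h

/-- The specification `ψ_i(rid)`. -/
def Protocol.spec (P : Protocol S F) (B : Type) (E : EqTheory S) (ρ : EqRestr F) (i : Fin n)
    (rid : S.Fresh) : Assertion S F.toFactSig n B :=
  fun h => ∃ p, ((Assertion.chunk (.token p)).sep (P.rolePred B E ρ i rid p 0)) h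

end RoleSpec

/-! ## Programs and verification -/

/-- The verifier assumption: whenever the triple `⊢_α {φ} c {true}` is derivable, the relabeled
program system `α(C)` is trace-included in `φ` (in particular, `α` is defined on all labels that
the program produces). -/
def VerifierAssumption {S : TermSig} {F : FactSig} {n : ℕ} {B : Type} {Prog : Type*}
    (sem : Prog → LTS (Label S F n B))
    (Verified : (Label S F n B → Option (Label S F n B)) → Assertion S F n B → Prog → Prop) :
    Prop :=
  ∀ α φ c, Verified α φ c →
    ((sem c).relabel α).traces ⊆ (fun τ => τ.map some) '' φ.traces

/-! ## The concrete system -/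

section System

variable {n : ℕ} {S : TermSig} {F : ProtoSig n}

/-- The renaming of the labels of the environment component: synchronization labels are extended
with bytestrings, other labels are kept. -/
inductive EnvRename (A : ByteAlg S) :
    Multiset (GFact S (XSig S F.toFactSig n)) → Label S F.toFactSig n A.Carrier → Prop
  | lab (i : Fin n) (k : Iface S F.toFactSig) (x : Fin k.nvars → Msg S) :
      EnvRename A {labFact i k x} (.cperm i k (fun j => A.γ (x j.val)) x)
  | other (a : Multiset (GFact S (XSig S F.toFactSig n))) :
      (∀ i k x, a ≠ {labFact i k x}) → EnvRename A a (.acts a)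

/-- The concrete environment. -/
noncomputable def Protocol.concreteEnv (P : Protocol S F) (E : EqTheory S) (A : ByteAlg S)
    (ok : Multiset (GFact S (XSig S F.toFactSig n)) → Prop) :
    LTS (Label S F.toFactSig n A.Carrier) where
  State := Multiset (GFact S (XSig S F.toFactSig n))
  start := 0
  step s ℓ s' := ∃ a, EnvRename A a ℓ ∧ (msrLTS E ok P.envRules).step s a s'

/-- The set `Λ` of all ground instances of synchronization labels. -/
def Protocol.syncLabels (P : Protocol S F) : Set (Multiset (GFact S (XSig S F.toFactSig n))) :=
  {a | ∃ i k, P.HasIface i k ∧ ∃ θ : Fin (roleHalf i k).nvars → Msg S,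
    a = (roleHalf i k).act.map (Fact.subst θ)}

/-- The set `Λ'`: the preimage under `π_ext ∘ π'_ext` of the labels that are equal modulo `E` to
one in `Λ`. -/
def Protocol.concreteSyncLabels (P : Protocol S F) (E : EqTheory S) (A : ByteAlg S) :
    Set (Label S F.toFactSig n A.Carrier) :=
  {ℓ | ∃ a, (piExt' A ℓ).map piExt = some (.acts a) ∧ ∃ a' ∈ P.syncLabels, MEq E a a'}

/-- The concrete system: the interleaving of all role instances `π_int(C_i(rid))`, synchronized
with the concrete environment. -/
noncomputable def Protocol.concreteSystem (P : Protocol S F) (E : EqTheory S) (A : ByteAlg S)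
    (ok : Multiset (GFact S (XSig S F.toFactSig n)) → Prop)
    (C : Fin n → S.Fresh → LTS (Label S F.toFactSig n A.Carrier)) :
    LTS (Label S F.toFactSig n A.Carrier) :=
  (LTS.interleave fun j : Fin n × S.Fresh => (C j.1 j.2).relabel piInt).sync
    (P.concreteSyncLabels E A) (.acts 0) (P.concreteEnv E A ok)

/-- The transition system of the original multiset rewriting system. -/
noncomputable def Protocol.model (P : Protocol S F) (E : EqTheory S) (B : Type) :
    LTS (Label S F.toFactSig n B) :=
  (msrLTS E (fun _ => True) P.rules).relabel fun a => .acts (a.map (baseFact n))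

open Classical in
/-- The traces of a system, with empty labels removed. -/
noncomputable def filteredTraces {F : FactSig} {B : Type} (A : LTS (Label S F n B)) :
    Set (List (Label S F n B)) :=
  (fun τ => τ.filter (fun ℓ => ℓ ≠ .acts 0)) '' A.traces

/-- No fresh name is generated at two different positions of the trace. -/
def CollisionFree (F : ProtoSig n) {B : Type} (τ : List (Label S F.toFactSig n B)) : Prop :=
  ∀ (i j : Fin τ.length) (a b : Multiset (GFact S (XSig S F.toFactSig n)))
    (g : GFact S F.toFactSig), g.sym = F.fr → τ.get i = .acts a → τ.get j = .acts b →
    baseFact n g ∈ a → baseFact n g ∈ b → i = j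

/-- The Tamarin traces of a system. -/
def tamarinTraces (F : ProtoSig n) {B : Type} (A : LTS (Label S F.toFactSig n B)) :
    Set (List (Label S F.toFactSig n B)) :=
  {τ ∈ filteredTraces A | CollisionFree F τ}

/-- The set of traces that satisfy the equality restrictions. -/
def EqRestr.traces (ρ : EqRestr F) (E : EqTheory S) (B : Type) :
    Set (List (Label S F.toFactSig n B)) :=
  {τ | ∀ a, Label.acts a ∈ τ → ρ.Sat E a}

end System

end ProtoImpl

open ProtoImpl

/-! The model simulates the concrete system, and the simulation has two independent ingredients.

The first extracts operational information from the specification. A trace of an assertion is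
possible in all of its heap models, so one well-chosen model already bounds the traces. Since places
are label sequences, a heap can be a tree: at each history it holds one permission for every label
enabled in the role state after that history, except that each input interface gets a single
permission, carrying a predicted value. Sorting these permissions by the first rule used below a
place splits the tree into disjoint forests, so the tree satisfies the role predicate coinductively
(`rolePred_permTree`). A wrong prediction would make the heap chaotic. The predictions are therefore
read off the very trace under consideration; the token then only follows permissions of the tree,
and each label of the trace is enabled where it occurs (`enabled_of_mem_spec_traces`).

The second ingredient puts the components together. Erasing the buffer decoration (`origin`) and
adding the states of the environment and of all active role instances gives a multiset of original
facts, which a reachable state of the model covers (`Covers`). An internal operation or an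
environment rule is an instance of a rule of the model. A synchronized input or output only moves a
fact between components, so the model stands still; a synchronized setup is one step of the model
with empty label. Coverage replaces equality because the two sides of a synchronization agree only
modulo `E` and because receiving a persistent fact duplicates it. The invariant `Simulated` records
all this, and that both runs agree literally once empty labels are dropped. Restrictions hold
because enabled operations carry their guard, environment steps are checked, and synchronizations
have the empty label. -/

namespace ProtoImpl

/-! ### Runs of labelled transition systems -/

namespace LTS

variable {L : Type} {A : LTS L}

theorem run_cons_iff {s t : A.State} {a : L} {τ : List L} :
    A.Run s (a :: τ) t ↔ ∃ s', A.step s a s' ∧ A.Run s' τ t := by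
  constructor
  · rintro (_ | ⟨h₁, h₂⟩)
    exact ⟨_, h₁, h₂⟩
  · rintro ⟨s', h₁, h₂⟩
    exact .cons h₁ h₂

theorem Run.append {s t u : A.State} {τ υ : List L} (h : A.Run s τ t) (h' : A.Run t υ u) :
    A.Run s (τ ++ υ) u := by
  induction h with
  | nil => exact h'
  | cons h₁ _ ih => exact .cons h₁ (ih h')

theorem Run.snoc {s t u : A.State} {τ : List L} {a : L} (h : A.Run s τ t) (h' : A.step t a u) :
    A.Run s (τ ++ [a]) u :=
  h.append (.cons h' (.nil u))

/-- Induction on the length of a run from the initial state, with the last step split off. -/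
theorem Run.start_induction {motive : List L → A.State → Prop} (nil : motive [] A.start)
    (snoc : ∀ τ s a t, motive τ s → A.step s a t → motive (τ ++ [a]) t)
    {τ : List L} {s : A.State} (h : A.Run A.start τ s) : motive τ s := by
  suffices H : ∀ {s τ t}, A.Run s τ t → ∀ υ, motive υ s → motive (υ ++ τ) t from
    H h [] nil
  intro s τ t h
  induction h with
  | nil => intro υ hυ; simpa using hυ
  | cons h₁ _ ih =>
    intro υ hυ
    simpa using ih _ (snoc _ _ _ _ hυ h₁)

end LTS

/-! ### Heaps that are trees of permissions -/

section Tree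

variable {S : TermSig} {F : FactSig} {n : ℕ} {B : Type}

/-- The permissions for the labels that `W` allows at the places below the children `ℓ :: p`
of `p` with `ℓ ∈ Ls`. -/
def permForest (W : Place S F n B → Label S F n B → Prop) (p : Place S F n B)
    (Ls : Set (Label S F n B)) : Set (Chunk S F n B) :=
  {c | ∃ q ℓ', c = .perm q ℓ' (ℓ' :: q) ∧ W q ℓ' ∧ ∃ ℓ ∈ Ls, (ℓ :: p) <:+ (ℓ' :: q)}

/-- The permissions for the labels that `W` allows at the place `p` and all places below. -/
def permTree (W : Place S F n B → Label S F n B → Prop) (p : Place S F n B) :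
    Set (Chunk S F n B) :=
  {c | ∃ q ℓ', c = .perm q ℓ' (ℓ' :: q) ∧ W q ℓ' ∧ p <:+ q}

variable {W : Place S F n B → Label S F n B → Prop} {p : Place S F n B}

theorem permForest_subset_permTree (Ls : Set (Label S F n B)) :
    permForest W p Ls ⊆ permTree W p := by
  rintro _ ⟨q, ℓ', rfl, hW, ℓ, -, hs⟩
  refine ⟨q, ℓ', rfl, hW, ?_⟩
  rcases List.suffix_cons_iff.1 hs with h | h
  · rw [(List.cons.inj h).2]
  · exact (List.suffix_cons ℓ p).trans h

theorem permForest_mono {Ls Ls' : Set (Label S F n B)} (h : Ls ⊆ Ls') :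
    permForest W p Ls ⊆ permForest W p Ls' := by
  rintro _ ⟨q, ℓ', rfl, hW, ℓ, hℓ, hs⟩
  exact ⟨q, ℓ', rfl, hW, ℓ, h hℓ, hs⟩

/-- Two children of `p` have equal length, so they coincide if both are suffixes of one place. This
is what lets a separating conjunction be met by cutting up a single tree. -/
theorem permForest_disjoint {Ls Ls' : Set (Label S F n B)} (h : Disjoint Ls Ls') :
    Disjoint (permForest W p Ls) (permForest W p Ls') := by
  rw [Set.disjoint_left] at h ⊢
  rintro _ ⟨q, ℓ', rfl, -, ℓ, hℓ, hs⟩ ⟨q₂, ℓ₂', hq, -, ℓ₂, hℓ₂, hs₂⟩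
  cases hq
  have := List.suffix_of_suffix_length_le hs hs₂ (by simp)
  have := this.eq_of_length (by simp)
  cases this
  exact h hℓ hℓ₂

/-- Disjoint parts are bounded by the whole in the form that `Assertion.bigSep` asks for, through
finite partial sums. -/
theorem sum_indicator_le {α ι : Type*} {t : ι → Set α} {u : Set α} (s : Finset ι)
    (hd : Pairwise fun i j => Disjoint (t i) (t j)) (hu : ∀ j, t j ⊆ u) :
    ∑ j ∈ s, (t j).indicator (1 : α → ℕ) ≤ u.indicator 1 := by
  intro a
  rw [Finset.sum_apply, ← Finset.indicator_biUnion_apply s t (fun i _ j _ hij => hd hij)]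
  exact Set.indicator_le_indicator_of_subset (by simpa using fun i _ => hu i) (by simp) a

theorem indicator_add_le {α : Type*} {s t u : Set α} (hd : Disjoint s t) (hs : s ⊆ u)
    (ht : t ⊆ u) : s.indicator (1 : α → ℕ) + t.indicator 1 ≤ u.indicator 1 := by
  refine (Set.indicator_union_of_disjoint hd 1).symm.trans_le ?_
  exact Set.indicator_le_indicator_of_subset (Set.union_subset hs ht) (by simp)

/-- A heap that contains the permission for an allowed label and the tree below it. -/
theorem sep_chunk_of_permForest {Ls : Set (Label S F n B)} {ℓ : Label S F n B} (hℓ : ℓ ∈ Ls)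
    (hW : W p ℓ) {φ : Assertion S F n B} (hφ : φ ((permTree W (ℓ :: p)).indicator 1)) :
    ((Assertion.chunk (.perm p ℓ (ℓ :: p))).sep φ) ((permForest W p Ls).indicator 1) := by
  refine ⟨({Chunk.perm p ℓ (ℓ :: p)} : Set _).indicator 1, _, indicator_add_le ?_ ?_ ?_, ?_, hφ⟩
  · rw [Set.disjoint_singleton_left]
    rintro ⟨q, ℓ', h, -, hs⟩
    cases h
    simpa using hs.length_le
  · rintro _ rfl
    exact ⟨p, ℓ, rfl, hW, ℓ, hℓ, List.suffix_rfl⟩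
  · rintro _ ⟨q, ℓ', rfl, hW', hs⟩
    exact ⟨q, ℓ', rfl, hW', ℓ, hℓ, hs.trans (List.suffix_cons _ _)⟩
  · simp [Assertion.chunk]

open Classical in
theorem heapStep_some {h : Heap S F n B} {ℓ : Label S F n B} {t : Option (Heap S F n B)}
    (hs : HeapStep (some h) ℓ t) :
    ∃ (k : Heap S F n B) (p p' : Place S F n B) (ℓ₀ : Label S F n B),
      h = k + Pi.single (Chunk.token p) 1 + Pi.single (Chunk.perm p ℓ₀ p') 1 ∧
      ((ℓ₀ = ℓ ∧ t = some (k + Pi.single (Chunk.token p') 1)) ∨ (SameCall ℓ₀ ℓ ∧ ℓ₀ ≠ ℓ)) := by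
  generalize hx : some h = x at hs
  cases hs with
  | move k p p' ℓ =>
    cases hx
    exact ⟨k, p, p', ℓ, rfl, .inl ⟨rfl, rfl⟩⟩
  | contradict k p p' ℓ₀ ℓ h₁ h₂ =>
    cases hx
    exact ⟨k, p, p', ℓ₀, rfl, .inr ⟨h₁, h₂⟩⟩
  | chaos => cases hx

/-- The heap with a token at the root and the permission tree `W` below it performs only labels
that `W` allows, if the predictions in `W` for input values are never wrong. -/
theorem permTree_run {τ : List (Label S F n B)}
    (hpred : ∀ q ℓ ℓ', W q ℓ → SameCall ℓ ℓ' → τ[q.length]? = some ℓ' → ℓ = ℓ')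
    {h₀ h : Heap S F n B} {t : Option (Heap S F n B)} {υ : List (Label S F n B)} {p₀ : Place S F n B}
    (htok : ∀ q, 1 ≤ h (.token q) → q = p₀)
    (htok' : h (.token p₀) ≤ 1)
    (hperm : ∀ q ℓ q', 1 ≤ h (.perm q ℓ q') → W q ℓ ∧ q' = ℓ :: q)
    (hτ : τ = p₀.reverse ++ υ) (hrun : (Heap.lts h₀).Run (some h) υ t) :
    ∀ u ℓ w, υ = u ++ ℓ :: w → W (u.reverse ++ p₀) ℓ := by
  classical
  induction υ generalizing h p₀ with
  | nil => intro u ℓ w hu; simp at hu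
  | cons a υ ih =>
    obtain ⟨t', hstep, hrun'⟩ := LTS.run_cons_iff.1 hrun
    obtain ⟨k, p, p', ℓ₀, rfl, h'⟩ := heapStep_some hstep
    obtain rfl : p = p₀ := htok p (by simp)
    obtain ⟨hW, rfl⟩ := hperm p ℓ₀ p' (by simp)
    -- A place is the reversed history, so its length is the position of the next label.
    have ha : τ[p.length]? = some a := by simp [hτ]
    rcases h' with ⟨rfl, rfl⟩ | ⟨hsame, hne⟩
    -- The heap has just one token, at `p`, so nothing but the moved token is left after the step.
    · have hk : ∀ q, k (.token q) = 0 := by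
        intro q
        by_contra hq
        obtain rfl := htok q (by simp; omega)
        simp at htok'
        exact hq htok'
      have := ih (h := k + Pi.single (Chunk.token (ℓ₀ :: p)) 1) (p₀ := ℓ₀ :: p) ?_ ?_ ?_ ?_ hrun'
      · intro u ℓ w hu
        cases u with
        | nil => cases hu; exact hW
        | cons b u =>
          cases hu
          simpa using this u ℓ w rfl
      · intro q hq
        by_contra hne
        simp [hk, hne] at hq
      · simp [hk]
      · intro q ℓ q' hq
        refine hperm q ℓ q' (le_trans hq ?_)
        simp
      · simp [hτ]
    -- A contradicting step would need the trace to return a value other than the predicted one;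
    -- hence the chaotic state is never entered.
    · exact absurd (hpred _ _ _ hW hsame ha) hne

end Tree

/-! ### From the role specification to enabled labels -/

section RoleSemantics

variable {n : ℕ} {S : TermSig} {F : ProtoSig n} {B : Type}

open Classical in
/-- The effect of an operation or permission on the state of a role component. -/
noncomputable def Label.next : Label S F.toFactSig n B → RoleState S F → RoleState S F
  | .op _ _ l _ r, s => update l r s
  | .perm i k x, s =>
      if k.IsOutput then update (roleHalfLhs i k x) 0 s else s + roleHalfRhs i k x
  | _, s => s

/-- The state of a role component at a place, that is, after a (reversed) sequence of labels. -/
noncomputable def stateAfter (p : Place S F.toFactSig n B) : RoleState S F :=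
  p.foldr Label.next 0

@[simp] theorem stateAfter_cons (ℓ : Label S F.toFactSig n B) (p : Place S F.toFactSig n B) :
    stateAfter (ℓ :: p) = ℓ.next (stateAfter p) := rfl

/-- The labels that the instance `rid` of role `i` can perform in the state `s`. -/
def Protocol.Enabled (P : Protocol S F) (E : EqTheory S) (ρ : EqRestr F) (i : Fin n)
    (rid : S.Fresh) (s : RoleState S F) : Label S F.toFactSig n B → Prop
  | .op R x l a r => R ∈ P.role i ∧ x R.rid = .fresh rid ∧ (F.bufferRule i R).Sorted x ∧
      (F.bufferRule i R).InstMod E x l a r ∧ Matches l s ∧ ρ.Sat E a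
  | .perm j k x => j = i ∧ P.HasIface i k ∧ x k.rid = .fresh rid ∧
      (k.IsOutput → Matches (roleHalfLhs i k x) s)
  | _ => False

/-- The labels that are enabled at a place and agree with the predictions `o` of input values. -/
def Protocol.Predicted (P : Protocol S F) (E : EqTheory S) (ρ : EqRestr F) (i : Fin n)
    (rid : S.Fresh)
    (o : Place S F.toFactSig n B → (k : Iface S F.toFactSig) → Fin k.nvars → Msg S)
    (p : Place S F.toFactSig n B) (ℓ : Label S F.toFactSig n B) : Prop :=
  P.Enabled E ρ i rid (stateAfter p) ℓ ∧
    ∀ j k x, ℓ = .perm j k x → ¬ k.IsOutput → x = o p k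

/-- The permission tree of the predicted labels satisfies the role predicate. -/
theorem rolePred_permTree (P : Protocol S F) (E : EqTheory S) (ρ : EqRestr F) (i : Fin n)
    (rid : S.Fresh)
    (o : Place S F.toFactSig n B → (k : Iface S F.toFactSig) → Fin k.nvars → Msg S)
    (ho : ∀ p k, o p k k.rid = .fresh rid) (p : Place S F.toFactSig n B) :
    P.rolePred B E ρ i rid p (stateAfter p)
      ((permTree (P.Predicted E ρ i rid o) p).indicator 1) := by
  -- The post-fixed point: the state is determined by the place, and the heap contains the tree
  -- below the place.
  refine ⟨fun q s h => s = stateAfter q ∧ (permTree (P.Predicted E ρ i rid o) q).indicator 1 ≤ h,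
    ?_, rfl, le_rfl⟩
  rintro q _ h ⟨rfl, hh⟩
  set W := P.Predicted E ρ i rid o with hW
  -- Each conjunct receives the forest below the labels of its own rule. Labels of different rules
  -- differ, so these forests are disjoint.
  let opLabels (R : RidRule S F.toFactSig) : Set (Label S F.toFactSig n B) :=
    {ℓ | ∃ x l a r, ℓ = .op R x l a r}
  let permLabels (k : Iface S F.toFactSig) : Set (Label S F.toFactSig n B) :=
    {ℓ | ∃ j x, ℓ = .perm j k x}
  refine ⟨(permForest W q (⋃ R, opLabels R)).indicator 1,
    (permForest W q (⋃ k, permLabels k)).indicator 1, le_trans (indicator_add_le ?_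
      (permForest_subset_permTree _) (permForest_subset_permTree _)) hh, ?_, ?_⟩
  · apply permForest_disjoint
    rw [Set.disjoint_left]
    simp only [Set.mem_iUnion]
    rintro _ ⟨R, x, l, a, r, rfl⟩ ⟨k, j, y, h⟩
    cases h
  · refine ⟨fun R => (permForest W q (opLabels R)).indicator 1, fun s => sum_indicator_le s ?_ ?_,
      ?_⟩
    · intro R R' hne
      apply permForest_disjoint
      rw [Set.disjoint_left]
      rintro _ ⟨x, l, a, r, rfl⟩ ⟨x', l', a', r', h⟩
      exact hne (Subtype.ext (Label.op.inj h).1)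
    · exact fun R => permForest_mono (Set.subset_iUnion _ _)
    -- The instances of one rule are quantified by an ordinary universal quantifier, not a
    -- separating one, so they may all use the same forest.
    · intro R x l a r hx hsort hinst hmatch hsat
      refine ⟨_, sep_chunk_of_permForest (ℓ := .op R.val x l a r)
        (show _ ∈ opLabels R from ⟨x, l, a, r, rfl⟩) ?_ ⟨rfl, le_rfl⟩⟩
      exact ⟨⟨R.property, hx, hsort, hinst, hmatch, hsat⟩, by rintro j k y h; cases h⟩
  · refine ⟨fun k => (permForest W q (permLabels k)).indicator 1,
      fun s => sum_indicator_le s ?_ ?_, ?_⟩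
    · intro k k' hne
      apply permForest_disjoint
      rw [Set.disjoint_left]
      rintro _ ⟨j, x, rfl⟩ ⟨j', x', h⟩
      exact hne (Subtype.ext (Label.perm.inj h).2.1)
    · exact fun R => permForest_mono (Set.subset_iUnion _ _)
    · rintro ⟨k, hk⟩
      -- An output must be served for every value in the buffer; for an input, the existential
      -- witness is the prediction `o q k`.
      refine ⟨fun hout x hx hmatch => ⟨_, sep_chunk_of_permForest (ℓ := .perm i k x)
        (show _ ∈ permLabels k from ⟨i, x, rfl⟩) ?_
        ⟨?_, le_rfl⟩⟩, fun hout => ⟨_, o q k, ho q k, sep_chunk_of_permForest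
          (ℓ := .perm i k (o q k)) (show _ ∈ permLabels k from ⟨i, _, rfl⟩) ?_ ⟨?_, le_rfl⟩⟩⟩
      · refine ⟨⟨rfl, hk, hx, fun _ => hmatch⟩, ?_⟩
        rintro j k' y h hnot
        cases h
        exact absurd hout hnot
      · simp [Label.next, hout]
      · refine ⟨⟨rfl, hk, ho q k, fun h => absurd h hout⟩, ?_⟩
        rintro j k' y h hnot
        cases h
        rfl
      · simp [Label.next, hout]

/-- Every label in a trace of the role specification is enabled where it occurs. -/
theorem enabled_of_mem_spec_traces (P : Protocol S F) (E : EqTheory S) (ρ : EqRestr F)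
    (i : Fin n) (rid : S.Fresh) {u : List (Label S F.toFactSig n B)} {ℓ : Label S F.toFactSig n B}
    (h : u ++ [ℓ] ∈ (P.spec B E ρ i rid).traces) :
    P.Enabled E ρ i rid (stateAfter u.reverse) ℓ := by
  classical
  -- The prediction at a place is the value that the given trace has at that position. The default
  -- only has to carry the right thread identifier, which the specification demands of every
  -- prediction.
  let o : Place S F.toFactSig n B → (k : Iface S F.toFactSig) → Fin k.nvars → Msg S :=
    fun p k =>
      if h : ∃ y : Fin k.nvars → Msg S, y k.rid = .fresh rid ∧
        ∃ j, (u ++ [ℓ])[p.length]? = some (.perm j k y) then h.choose else fun _ => .fresh rid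
  have ho : ∀ p k, o p k k.rid = .fresh rid := by
    intro p k
    simp only [o]
    split_ifs with h
    · exact h.choose_spec.1
    · rfl
  have htree := rolePred_permTree P E ρ i rid o ho []
  set W := P.Predicted E ρ i rid o with hW
  obtain ⟨t, ht⟩ := h ((permTree W []).indicator 1 + Pi.single (Chunk.token []) 1)
    ⟨[], Pi.single (Chunk.token []) 1, (permTree W []).indicator 1, (add_comm _ _).le,
      by simp [Assertion.chunk], htree⟩
  have htok : ∀ q, (permTree W []).indicator (1 : Chunk S F.toFactSig n B → ℕ) (.token q) = 0 := by
    intro q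
    apply Set.indicator_of_notMem
    rintro ⟨_, _, h, -⟩
    cases h
  have := permTree_run (W := W) (τ := u ++ [ℓ]) (p₀ := []) ?_ ?_ ?_ ?_ (by simp) ht u ℓ [] rfl
  · simpa using this.1
  · rintro q ℓ₁ ℓ₂ hq hsame hτ
    cases hsame with
    | refl => rfl
    -- The caller provides the thread identifier, so the value `y` in the trace passes the test in
    -- `o`; as the trace has one label at this position, the chosen prediction is `y`.
    | inp j k x y hk hxy =>
      obtain ⟨⟨rfl, -, hx, -⟩, hpred⟩ := hq
      have hx' := hpred _ _ _ rfl hk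
      have hex : ∃ y : Fin k.nvars → Msg S, y k.rid = .fresh rid ∧
        ∃ j, (u ++ [ℓ])[q.length]? = some (.perm j k y) := ⟨y, hxy ▸ hx, j, hτ⟩
      obtain ⟨j', hj'⟩ := hex.choose_spec.2
      have : o q k = hex.choose := dif_pos hex
      replace hj' := hτ.symm.trans hj'
      simp only [Option.some.injEq, Label.perm.injEq, heq_eq_eq, true_and] at hj'
      rw [hx', this, ← hj'.2]
  · intro q hq
    by_contra hne
    simp [htok, hne] at hq
  · simp [htok]
  · intro q ℓ' q' hq
    simp only [Pi.add_apply, Pi.single_apply, reduceCtorEq, if_false, add_zero] at hq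
    have hm := Set.mem_of_indicator_ne_zero (Nat.one_le_iff_ne_zero.1 hq)
    obtain ⟨_, _, h, hW, -⟩ := hm
    cases h
    exact ⟨hW, rfl⟩

end RoleSemantics

/-! ### Facts and multisets modulo `E` -/

section Modulo

variable {S : TermSig} {F : FactSig} {V W : Type} {E : EqTheory S}

theorem EqMod.subst_congr {x y : V → Term S W} (h : ∀ v, EqMod E (x v) (y v)) (t : Term S V) :
    EqMod E (t.subst x) (t.subst y) := by
  induction t with
  | fresh | pub => exact .refl _
  | var v => exact h v
  | app f ts ih => exact .app f ih

namespace Fact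

theorem EqMod.rfl {g : Fact S F V} : Fact.EqMod E g g :=
  .mk g.sym fun _ => .refl _

theorem EqMod.symm {g h : Fact S F V} (hg : Fact.EqMod E g h) : Fact.EqMod E h g := by
  obtain ⟨f, hf⟩ := hg
  exact .mk f fun j => (hf j).symm

theorem EqMod.sym_eq {g h : Fact S F V} (hg : Fact.EqMod E g h) : g.sym = h.sym := by
  obtain ⟨f, hf⟩ := hg
  rfl

theorem EqMod.args {f : F.Sym} {ts us : Fin (F.arity f) → Term S V}
    (h : Fact.EqMod E ⟨f, ts⟩ ⟨f, us⟩) : ∀ j, ProtoImpl.EqMod E (ts j) (us j) := by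
  cases h with
  | mk _ h => exact h

theorem EqMod.trans {g h k : Fact S F V} (hg : Fact.EqMod E g h) (hh : Fact.EqMod E h k) :
    Fact.EqMod E g k := by
  obtain ⟨f, hf⟩ := hg
  obtain ⟨f', us⟩ := k
  obtain rfl : f = f' := hh.sym_eq
  exact .mk f fun j => (hf j).trans (hh.args j)

theorem subst_congr {x y : V → Term S W} (h : ∀ v, ProtoImpl.EqMod E (x v) (y v))
    (g : Fact S F V) : Fact.EqMod E (g.subst x) (g.subst y) :=
  .mk g.sym fun j => EqMod.subst_congr h (g.args j)

end Fact

theorem MEq.refl (m : Multiset (Fact S F V)) : MEq E m m :=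
  Multiset.rel_refl_of_refl_on fun _ _ => Fact.EqMod.rfl

theorem MEq.of_eq {m m' : Multiset (Fact S F V)} (h : m = m') : MEq E m m' :=
  h ▸ MEq.refl m

theorem MEq.symm {m m' : Multiset (Fact S F V)} (h : MEq E m m') : MEq E m' m :=
  Multiset.rel_flip.1 (h.mono fun _ _ _ _ hg => hg.symm)

theorem MEq.trans {m m' m'' : Multiset (Fact S F V)} (h : MEq E m m') (h' : MEq E m' m'') :
    MEq E m m'' := by
  have : IsTrans (Fact S F V) (Fact.EqMod E) := ⟨fun _ _ _ => Fact.EqMod.trans⟩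
  exact Multiset.Rel.trans _ h h'

theorem MEq.add {m m' k k' : Multiset (Fact S F V)} (h : MEq E m m') (h' : MEq E k k') :
    MEq E (m + k) (m' + k') :=
  Multiset.Rel.add h h'

theorem MEq.map_subst {x y : V → Term S W} (h : ∀ v, EqMod E (x v) (y v))
    (m : Multiset (Fact S F V)) : MEq E (m.map (Fact.subst x)) (m.map (Fact.subst y)) :=
  Multiset.rel_map.2 (Multiset.rel_refl_of_refl_on fun g _ => Fact.subst_congr h g)

theorem MEq.singleton {g h : Fact S F V} (hg : Fact.EqMod E g h) : MEq E {g} {h} :=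
  .cons hg .zero

theorem MEq.of_singleton {g h : Fact S F V} (hg : MEq E {g} {h}) : Fact.EqMod E g h := by
  obtain ⟨b, m, hb, -, hm⟩ := Multiset.rel_cons_right.1 hg
  rwa [((Multiset.singleton_eq_cons_iff _).1 hm).1]

/-- Equality modulo `E` keeps fact symbols, and persistence depends on the symbol alone. -/
theorem MEq.linPart {m m' : Multiset (GFact S F)} (h : MEq E m m') :
    MEq E (linPart m) (linPart m') := by
  classical
  induction h with
  | zero => exact .refl _
  | @cons g g' m m' hg hm ih =>
    unfold ProtoImpl.linPart at ih ⊢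
    by_cases hp : F.persistent g.sym
    · have hp' : F.persistent g'.sym := hg.sym_eq ▸ hp
      simpa [hp, hp'] using ih
    · have hp' : ¬ F.persistent g'.sym := hg.sym_eq ▸ hp
      simpa [hp, hp', MEq] using Multiset.Rel.cons hg ih

end Modulo

/-! ### Covering of states modulo `E` -/

section States

variable {S : TermSig} {F : FactSig} {E : EqTheory S}

@[simp] theorem linPart_add (m m' : Multiset (GFact S F)) :
    linPart (m + m') = linPart m + linPart m' := by
  simp [linPart]

@[simp] theorem linPart_zero : linPart (0 : Multiset (GFact S F)) = 0 := by
  simp [linPart]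

theorem not_persistent_of_mem_linPart {m : Multiset (GFact S F)} {g : GFact S F}
    (h : g ∈ linPart m) : ¬ F.persistent g.sym := by
  simp only [linPart, Multiset.mem_filter] at h
  exact h.2

theorem linPart_eq_self {m : Multiset (GFact S F)} (h : ∀ g ∈ m, ¬ F.persistent g.sym) :
    linPart m = m := by
  classical exact Multiset.filter_eq_self.2 h

@[simp] theorem linPart_linPart (m : Multiset (GFact S F)) : linPart (linPart m) = linPart m :=
  linPart_eq_self fun _ => not_persistent_of_mem_linPart

theorem linPart_eq_zero {m : Multiset (GFact S F)} (h : ∀ g ∈ m, F.persistent g.sym) :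
    linPart m = 0 := by
  classical exact Multiset.filter_eq_nil.2 (by simpa using h)

theorem update_of_add (l r s : Multiset (GFact S F)) : update l r (linPart l + s) = s + r := by
  simp [update]

theorem update_zero_add (l r s : Multiset (GFact S F)) : update l 0 s + r = update l r s := by
  simp [update]

theorem update_zero_left (r s : Multiset (GFact S F)) : update 0 r s = s + r := by
  simp [update]

/-- `T` contains, modulo `E`, the linear facts of `G` with their multiplicities and the persistent
facts of `G`. -/
def Covers (E : EqTheory S) (T G : Multiset (GFact S F)) : Prop :=
  (∃ L ≤ T, MEq E L (linPart G)) ∧ ∀ g ∈ G, F.persistent g.sym → ∃ g' ∈ T, Fact.EqMod E g' g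

/-- Persistent facts need only be found, not counted, so the new state may duplicate them. -/
theorem Covers.congr {T G G' : Multiset (GFact S F)} (h : Covers E T G)
    (hlin : MEq E (linPart G) (linPart G'))
    (hper : ∀ g ∈ G', F.persistent g.sym → ∃ g₀ ∈ G, Fact.EqMod E g₀ g) : Covers E T G' := by
  obtain ⟨⟨L, hL, hLG⟩, hp⟩ := h
  refine ⟨⟨L, hL, hLG.trans hlin⟩, fun g hg hgp => ?_⟩
  obtain ⟨g₀, hg₀, he⟩ := hper g hg hgp
  obtain ⟨g', hg', he'⟩ := hp g₀ hg₀ (he.sym_eq ▸ hgp)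
  exact ⟨g', hg', he'.trans he⟩

/-- Moving the facts `l` from one part of the covered state to another, modulo `E`. -/
theorem Covers.transfer {T X Y l l' : Multiset (GFact S F)} (h : Covers E T (X + Y))
    (hm : Matches l X) (hl : MEq E l' l) : Covers E T (update l 0 X + l' + Y) := by
  obtain ⟨hle, hper⟩ := hm
  obtain ⟨X', rfl⟩ := Multiset.le_iff_exists_add.1 hle
  rw [update_of_add, add_zero]
  -- The linear facts are merely rearranged. The persistent facts of `l` stay in place, and those of
  -- `l'` duplicate them modulo `E`.
  refine h.congr ?_ fun g hg hgp => ?_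
  · simp only [linPart_add, linPart_linPart]
    rw [add_comm (linPart l)]
    exact ((MEq.refl _).add hl.symm.linPart).add (.refl _)
  · simp only [Multiset.mem_add] at hg
    rcases hg with (hg | hg) | hg
    · exact ⟨g, by simp [hg], .rfl⟩
    · obtain ⟨g₀, hg₀, he⟩ := Multiset.exists_mem_of_rel_of_mem hl hg
      exact ⟨g₀, Multiset.mem_add.2 (.inl (hper g₀ hg₀ (he.sym_eq ▸ hgp))), he.symm⟩
    · exact ⟨g, by simp [hg], .rfl⟩

/-- Counterparts are chosen occurrence by occurrence and may repeat, which suffices for persistent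
premises. -/
theorem exists_rel_of_forall_mem {α : Type*} {r : α → α → Prop} {p : α → Prop} (m : Multiset α)
    (h : ∀ a ∈ m, ∃ b, p b ∧ r b a) : ∃ m', Multiset.Rel r m' m ∧ ∀ b ∈ m', p b := by
  induction m using Multiset.induction with
  | empty => exact ⟨0, .zero, by simp⟩
  | cons a m ih =>
    obtain ⟨m', hm', hp⟩ := ih fun a ha => h a (Multiset.mem_cons_of_mem ha)
    obtain ⟨b, hb, hr⟩ := h a (Multiset.mem_cons_self a m)
    exact ⟨b ::ₘ m', .cons hr hm', by simpa [hb] using hp⟩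

/-- A rule that is applicable in a part of the covered state is applicable, modulo `E`, in the
covering state. -/
theorem Covers.step {T X Y l : Multiset (GFact S F)} (h : Covers E T (X + Y))
    (hm : Matches l X) : ∃ l', MEq E l' l ∧ Matches l' T ∧
      ∀ r, Covers E (update l' r T) (update l 0 X + r + Y) := by
  classical
  obtain ⟨hle, hper⟩ := hm
  obtain ⟨X', rfl⟩ := Multiset.le_iff_exists_add.1 hle
  obtain ⟨⟨L, hL, hLG⟩, hp⟩ := h
  rw [add_assoc, linPart_add, linPart_linPart] at hLG
  -- `L₁` is the counterpart of the linear facts to be consumed and `L₂` that of the remaining ones;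
  -- `T'` below is the rest of the covering state.
  obtain ⟨L₁, L₂, h₁, h₂, rfl⟩ := Multiset.rel_add_right.1 hLG
  obtain ⟨T', rfl⟩ := Multiset.le_iff_exists_add.1 hL
  obtain ⟨Q, hQ, hQT⟩ := exists_rel_of_forall_mem (r := Fact.EqMod E)
    (p := fun g' => F.persistent g'.sym ∧ g' ∈ L₁ + L₂ + T')
    (l.filter fun g => F.persistent g.sym) (by
      intro g hg
      obtain ⟨hg, hgp⟩ := Multiset.mem_filter.1 hg
      obtain ⟨g', hg', he⟩ := hp g (Multiset.mem_add.2 (.inl (hper g hg hgp))) hgp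
      exact ⟨g', ⟨he.sym_eq ▸ hgp, hg'⟩, he⟩)
  have hlin : ∀ g ∈ L₁, ¬ F.persistent g.sym := by
    intro g hg
    obtain ⟨g₀, hg₀, he⟩ := Multiset.exists_mem_of_rel_of_mem h₁ hg
    exact he.sym_eq ▸ not_persistent_of_mem_linPart hg₀
  have hl' : linPart (L₁ + Q) = L₁ := by
    rw [linPart_add, linPart_eq_self hlin, linPart_eq_zero fun g hg => (hQT g hg).1, add_zero]
  refine ⟨L₁ + Q, ?_, ⟨?_, ?_⟩, fun r => ?_⟩
  · have : linPart l + l.filter (fun g => F.persistent g.sym) = l := by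
      rw [linPart, add_comm]
      exact Multiset.filter_add_not _ l
    rw [← this]
    exact MEq.add h₁ hQ
  · rw [hl', add_assoc]
    exact Multiset.le_add_right _ _
  · intro g hg hgp
    rcases Multiset.mem_add.1 hg with hg | hg
    · exact absurd hgp (hlin g hg)
    · exact (hQT g hg).2
  · have hu : update (L₁ + Q) r (L₁ + L₂ + T') = L₂ + T' + r := by
      have := update_of_add (L₁ + Q) r (L₂ + T')
      rwa [hl', ← add_assoc] at this
    rw [hu, update_of_add, add_zero]
    refine ⟨⟨L₂ + linPart r, ?_, ?_⟩, fun g hg hgp => ?_⟩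
    · have hr : linPart r ≤ r := Multiset.filter_le _ _
      exact add_le_add (Multiset.le_add_right _ _) hr
    · have : linPart (X' + r + Y) = linPart (X' + Y) + linPart r := by
        simp only [linPart_add]
        exact add_right_comm _ _ _
      rw [this]
      exact MEq.add h₂ (.refl _)
    · simp only [Multiset.mem_add] at hg
      by_cases hgr : g ∈ r
      · exact ⟨g, by simp [hgr], .rfl⟩
      · obtain ⟨g', hg', he⟩ := hp g (by simp only [Multiset.mem_add]; tauto) hgp
        refine ⟨g', ?_, he⟩
        -- Only the linear facts `L₁` are removed from the covering state, so a persistent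
        -- counterpart survives.
        have : g' ∉ L₁ := fun hg' => hlin g' hg' (he.sym_eq ▸ hgp)
        simp only [Multiset.mem_add] at hg' ⊢
        tauto

end States

/-! ### Erasing the buffer decoration -/

section Origin

variable {S : TermSig} {F : FactSig} {n : ℕ} {E : EqTheory S} {V W : Type}

/-- The fact over the original signature that a fact of a component stands for. -/
def XFact.origin : XFact S F n V → Option (Fact S F V)
  | ⟨.base f, ts⟩ => some ⟨f, ts⟩
  | ⟨.buf _ f, ts⟩ => some ⟨f, Fin.tail (α := fun _ : Fin (F.arity f + 1) => Term S V) ts⟩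
  | ⟨.lab _ _, _⟩ => none

/-- The state over the original signature that a component state stands for. -/
def origin (m : Multiset (XFact S F n V)) : Multiset (Fact S F V) :=
  m.filterMap XFact.origin

@[simp] theorem origin_zero : origin (0 : Multiset (XFact S F n V)) = 0 := rfl

@[simp] theorem origin_add (m m' : Multiset (XFact S F n V)) :
    origin (m + m') = origin m + origin m' :=
  Multiset.filterMap_add _ _ _

/-- A buffered copy inherits its persistence from the original symbol, and labels are erased on both
sides. -/
theorem origin_linPart (m : Multiset (GFact S (XSig S F n))) :
    origin (linPart m) = linPart (origin m) := by
  classical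
  unfold origin linPart
  rw [Multiset.filter_filterMap, Multiset.filterMap_filter]
  congr 1
  funext ⟨f, ts⟩
  cases f with
  | base f | buf _ f =>
    by_cases h : F.persistent f <;> simp [XFact.origin, XSym.Persistent, Option.filter, h]
  | lab _ _ => simp [XFact.origin, XSym.Persistent]

theorem origin_matches {l s : Multiset (GFact S (XSig S F n))} (h : Matches l s) :
    Matches (origin l) (origin s) := by
  refine ⟨?_, fun g hg hp => ?_⟩
  · rw [← origin_linPart]
    exact Multiset.filterMap_le_filterMap _ h.1
  · obtain ⟨g', hg', he⟩ := (Multiset.mem_filterMap _ _).1 hg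
    refine (Multiset.mem_filterMap _ _).2 ⟨g', h.2 g' hg' ?_, he⟩
    obtain ⟨f, ts⟩ := g'
    cases f <;> simp only [XFact.origin, Option.some.injEq, reduceCtorEq] at he <;> subst he <;>
      exact hp

/-- Multiset subtraction does not commute with a map that may identify facts; it does here because
the subtracted linear part is contained in `s`. -/
theorem origin_update {l r s : Multiset (GFact S (XSig S F n))} (h : Matches l s) :
    origin (update l r s) = update (origin l) (origin r) (origin s) := by
  obtain ⟨s', rfl⟩ := Multiset.le_iff_exists_add.1 h.1
  rw [update_of_add, origin_add, origin_add, origin_linPart, update_of_add]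

theorem MEq.origin {m m' : Multiset (XFact S F n V)} (h : MEq E m m') :
    MEq E (origin m) (origin m') := by
  induction h with
  | zero => exact .refl _
  | @cons g g' m m' hg hm ih =>
    obtain ⟨f, h⟩ := hg
    unfold ProtoImpl.origin at ih ⊢
    cases f with
    | base f =>
      rw [Multiset.filterMap_cons_some XFact.origin _ _ rfl,
        Multiset.filterMap_cons_some XFact.origin _ _ rfl]
      exact .cons (.mk f h) ih
    | buf i f =>
      rw [Multiset.filterMap_cons_some XFact.origin _ _ rfl,
        Multiset.filterMap_cons_some XFact.origin _ _ rfl]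
      exact .cons (.mk f fun j => h j.succ) ih
    | lab i k =>
      rw [Multiset.filterMap_cons_none _ _ rfl, Multiset.filterMap_cons_none _ _ rfl]
      exact ih

theorem origin_map {f : Fact S F V → XFact S F n W} {g : Fact S F V → Fact S F W}
    (h : ∀ a, (f a).origin = some (g a)) (m : Multiset (Fact S F V)) :
    origin (m.map f) = m.map g := by
  rw [origin, Multiset.filterMap_map, ← Multiset.filterMap_eq_map]
  exact congrArg (Multiset.filterMap · m) (funext h)

theorem origin_map_baseFact_subst (x : V → Term S W) (m : Multiset (Fact S F V)) :
    origin ((m.map (baseFact n)).map (Fact.subst x)) = m.map (Fact.subst x) := by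
  rw [Multiset.map_map]
  exact origin_map (fun _ => rfl) m

/-- Erasure drops exactly the thread identifier that buffering adds, so a buffered role rule erases
to the original rule. -/
theorem origin_map_bufferize_subst {F : ProtoSig n} (i : Fin n) (t : Term S V) (x : V → Term S W)
    (m : Multiset (Fact S F.toFactSig V)) :
    origin ((m.map (F.bufferize i t)).map (Fact.subst x)) = m.map (Fact.subst x) := by
  rw [Multiset.map_map]
  refine origin_map (fun g => ?_) m
  by_cases h : F.Buffered g.sym
  · simp only [Function.comp, ProtoSig.bufferize, if_pos h]
    rfl
  · simp only [Function.comp, ProtoSig.bufferize, if_neg h]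
    rfl

/-- A multiset of facts that equals modulo `E` one over the original signature is over the original
signature. -/
theorem exists_map_baseFact_of_mEq {x : V → Term S W} {a : Multiset (XFact S F n W)}
    {m : Multiset (Fact S F V)} (h : MEq E a ((m.map (baseFact n)).map (Fact.subst x))) :
    ∃ a₀ : Multiset (Fact S F W), a = a₀.map (baseFact n) ∧ MEq E a₀ (m.map (Fact.subst x)) := by
  induction m using Multiset.induction generalizing a with
  | empty =>
    obtain rfl := Multiset.rel_zero_right.1 h
    exact ⟨0, rfl, .zero⟩
  | cons g m ih =>
    rw [Multiset.map_cons, Multiset.map_cons] at h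
    obtain ⟨b, a', hb, ha', rfl⟩ := Multiset.rel_cons_right.1 h
    obtain ⟨a₀, rfl, ha₀⟩ := ih ha'
    obtain ⟨f, ts⟩ := b
    obtain rfl : f = .base g.sym := hb.sym_eq
    exact ⟨⟨g.sym, ts⟩ ::ₘ a₀, by simp [baseFact], by
      rw [Multiset.map_cons]
      exact .cons (.mk g.sym hb.args) ha₀⟩

end Origin

/-! ### Component steps as steps of the model -/

section Components

variable {n : ℕ} {S : TermSig} {E : EqTheory S} {F : ProtoSig n} {B : Type}
  {P : Protocol S F}

/-- A rule of the model that is applicable in a component state has, modulo `E`, a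
corresponding step of the model. -/
theorem Covers.msr_step {T Y : Multiset (GFact S F.toFactSig)}
    {l s : Multiset (GFact S (XSig S F.toFactSig n))} {a r : Multiset (GFact S F.toFactSig)}
    (h : Covers E T (origin s + Y)) (hm : Matches l s)
    {R : Rule S F.toFactSig} (hR : R ∈ P.rules) {x : Fin R.nvars → Msg S} (hx : R.Sorted x)
    (hl : MEq E (origin l) (R.lhs.map (Fact.subst x))) (ha : MEq E a (R.act.map (Fact.subst x)))
    (hr : MEq E r (R.rhs.map (Fact.subst x))) :
    ∃ T', (P.model E B).step T (.acts (a.map (baseFact n))) T' ∧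
      Covers E T' (origin (update l 0 s) + r + Y) := by
  obtain ⟨l', hl', hm', hc⟩ := h.step (origin_matches hm)
  -- Instances are closed under equality modulo `E` separately in premises, label and conclusions.
  -- Only the premises change to `l'`, so the label is matched literally.
  refine ⟨update l' r T, ⟨a, rfl, R, hR, x, l', r, hx, ⟨hl'.trans hl, ha, hr⟩, trivial, hm', rfl⟩,
    ?_⟩
  rw [origin_update hm]
  exact hc r

/-- A step of a role component for a protocol rule. -/
theorem Covers.role_step {ρ : EqRestr F} {i : Fin n} {rid : S.Fresh}
    {T Y : Multiset (GFact S F.toFactSig)} {s l a r : RoleState S F} {R : RidRule S F.toFactSig}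
    {x : Fin R.nvars → Msg S} (h : Covers E T (origin s + Y))
    (hen : P.Enabled E ρ i rid s (.op R x l a r : Label S F.toFactSig n B)) :
    ∃ T', (P.model E B).step T (.acts a) T' ∧ Covers E T' (origin (update l r s) + Y) := by
  obtain ⟨hR, -, hx, ⟨hl, ha, hr⟩, hm, -⟩ := hen
  obtain ⟨a, rfl, ha'⟩ := exists_map_baseFact_of_mEq ha
  have hl := hl.origin
  have hr := hr.origin
  simp only [ProtoSig.bufferRule, origin_map_bufferize_subst] at hl hr
  obtain ⟨T', hstep, hc⟩ := h.msr_step (P := P) (B := B) hm (.inr ⟨i, R, hR, rfl⟩) hx hl ha' hr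
  refine ⟨T', hstep, ?_⟩
  rwa [← origin_add, update_zero_add] at hc

/-- A step of the environment component for an environment rule of the model. -/
theorem Covers.env_step {T Y : Multiset (GFact S F.toFactSig)}
    {s l a r : Multiset (GFact S (XSig S F.toFactSig n))} {R : Rule S F.toFactSig}
    (hR : R ∈ P.env) {x : Fin R.nvars → Msg S} (h : Covers E T (origin s + Y))
    (hx : R.Sorted x) (hinst : (baseRule n R).InstMod E x l a r) (hm : Matches l s) :
    ∃ T', (P.model E B).step T (.acts a) T' ∧ Covers E T' (origin (update l r s) + Y) := by
  obtain ⟨hl, ha, hr⟩ := hinst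
  obtain ⟨a, rfl, ha'⟩ := exists_map_baseFact_of_mEq ha
  have hl := hl.origin
  have hr := hr.origin
  simp only [baseRule, origin_map_baseFact_subst] at hl hr
  obtain ⟨T', hstep, hc⟩ := h.msr_step (P := P) (B := B) hm (.inl hR) hx hl ha' hr
  refine ⟨T', hstep, ?_⟩
  rwa [← origin_add, update_zero_add] at hc

theorem labFact_eqMod_iff {V : Type} {i j : Fin n} {k : Iface S F.toFactSig}
    {x y : Fin k.nvars → Term S V} :
    Fact.EqMod E (labFact i k x) (labFact j k y) ↔ i = j ∧ ∀ v, EqMod E (x v) (y v) := by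
  constructor
  · intro h
    obtain rfl : i = j := (XSym.lab.inj h.sym_eq).1
    exact ⟨rfl, h.args⟩
  · rintro ⟨rfl, h⟩
    exact Fact.EqMod.mk (F := XSig S F.toFactSig n) (XSym.lab i k) h

/-- A synchronization of an enabled interface step of a role with the environment. -/
theorem Covers.sync_step (hP : P.WellFormed) {ρ : EqRestr F} {i : Fin n} {rid : S.Fresh}
    {T Y : Multiset (GFact S F.toFactSig)} {s : RoleState S F}
    {e l r : Multiset (GFact S (XSig S F.toFactSig n))} {k : Iface S F.toFactSig}
    {x : Fin k.nvars → Msg S} (h : Covers E T (origin e + (origin s + Y)))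
    (hen : P.Enabled E ρ i rid s (.perm i k x : Label S F.toFactSig n B))
    {y : Fin (envHalf (n := n) i k).nvars → Msg S} (hy : (envHalf i k).Sorted y)
    (hinst : (envHalf i k).InstMod E y l {labFact i k x} r) (hm : Matches l e) :
    ∃ T' τ, (P.model E B).Run T τ T' ∧ (∀ ℓ ∈ τ, ℓ = .acts 0) ∧
      Covers E T' (origin (update l r e) +
        (origin ((Label.perm i k x : Label S F.toFactSig n B).next s) + Y)) := by
  obtain ⟨hl, ha, hr⟩ := hinst
  obtain ⟨-, hk, -, hms⟩ := hen
  cases k with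
  | inp f =>
    have ha : MEq E {labFact i (.inp f) x} {labFact i (.inp f) y} := ha
    have hxy := (labFact_eqMod_iff.1 (MEq.of_singleton ha)).2
    have hx : MEq E (origin (roleHalfRhs (n := n) i (.inp f) x)) (origin l) := by
      refine MEq.trans ?_ hl.origin.symm
      show MEq E {⟨f, fun j => x j.succ⟩} {⟨f, fun j => y j.succ⟩}
      exact .singleton (.mk f fun j => hxy j.succ)
    obtain rfl := Multiset.rel_zero_right.1 hr
    -- After erasure, the fact taken from the environment and the buffered fact agree modulo `E`:
    -- the model stands still while the fact changes owner.
    refine ⟨T, [], .nil _, by simp, ?_⟩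
    have := h.transfer (origin_matches hm) hx
    have hn : (Label.perm i (.inp f) x : Label S F.toFactSig n B).next s =
      s + roleHalfRhs i (.inp f) x := if_neg fun h => h
    rw [hn, origin_update hm, origin_zero, origin_add]
    simpa only [add_assoc, add_comm, add_left_comm] using this
  | out f =>
    have ha : MEq E {labFact i (.out f) x} {labFact i (.out f) y} := ha
    have hxy := (labFact_eqMod_iff.1 (MEq.of_singleton ha)).2
    have hx : MEq E (origin r) (origin (roleHalfLhs (n := n) i (.out f) x)) :=
      MEq.trans (m' := {⟨f, fun j => y j.succ⟩}) hr.origin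
        (show MEq E _ {⟨f, fun j => x j.succ⟩} from
          .singleton (.mk f fun j => (hxy j.succ).symm))
    obtain rfl := Multiset.rel_zero_right.1 hl
    refine ⟨T, [], .nil _, by simp, ?_⟩
    rw [add_left_comm] at h
    have := h.transfer (origin_matches (hms trivial)) hx
    have hn : (Label.perm i (.out f) x : Label S F.toFactSig n B).next s =
      update (roleHalfLhs i (.out f) x) 0 s := if_pos trivial
    rw [hn, update_zero_left, origin_update (hms trivial), origin_add]
    simpa only [add_assoc, add_comm, add_left_comm, origin_zero] using this
  | setup R =>
    have ha : MEq E {labFact i (.setup R) x} {labFact i (.setup R) y} := ha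
    have hxy := (labFact_eqMod_iff.1 (MEq.of_singleton ha)).2
    obtain ⟨hR, g, hg, hrhs, -⟩ := hk
    -- Well-formedness makes the label of a setup rule empty, so the step of the model is invisible
    -- after filtering.
    have hact := (hP.env_setup _ hR i g (by simp [hrhs]) hg).1
    obtain rfl := Multiset.rel_zero_right.1 hr
    have hl : MEq E (origin l) (R.lhs.map (Fact.subst (V := Fin R.nvars) y)) :=
      MEq.trans hl.origin (.of_eq (origin_map_baseFact_subst (V := Fin R.nvars) y R.lhs))
    have hx : origin (roleHalfRhs (n := n) i (.setup R) x) = R.rhs.map (Fact.subst x) :=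
      origin_map_baseFact_subst x R.rhs
    -- The two halves recombine into one rule instance: sorts and premises come from the
    -- environment's `y`, the conclusion from the role's `x`, which is equal modulo `E`.
    obtain ⟨T', hstep, hc⟩ := h.msr_step (P := P) (B := B) (a := 0)
      (r := origin (roleHalfRhs (n := n) i (.setup R) x)) hm (.inl hR) hy hl
      (by rw [hact]; exact .refl _) (hx ▸ MEq.map_subst hxy _)
    refine ⟨T', [.acts 0], .cons hstep (.nil _), by simp, ?_⟩
    have hn : (Label.perm i (.setup R) x : Label S F.toFactSig n B).next s =
      s + roleHalfRhs i (.setup R) x := if_neg fun h => h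
    rw [hn, origin_add]
    simpa only [add_assoc, add_comm, add_left_comm] using hc

end Components

/-! ### Simulation of the concrete system -/

section Composition

variable {n : ℕ} {S : TermSig} {E : EqTheory S} {A : ByteAlg S} {F : ProtoSig n}
  {P : Protocol S F}

theorem exists_envHalf_act_eq_labFact (i : Fin n) (k : Iface S F.toFactSig)
    (y : Fin (envHalf (n := n) i k).nvars → Msg S) :
    ∃ y' : Fin k.nvars → Msg S, (envHalf i k).act.map (Fact.subst y) = {labFact i k y'} := by
  cases k <;> exact ⟨y, rfl⟩

theorem exists_labFact_eq_roleHalf_act (i : Fin n) (k : Iface S F.toFactSig)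
    (x : Fin k.nvars → Msg S) :
    ∃ θ : Fin (roleHalf (n := n) i k).nvars → Msg S,
      ({labFact i k x} : Multiset _) = (roleHalf i k).act.map (Fact.subst θ) := by
  cases k <;> exact ⟨x, rfl⟩

theorem exists_roleHalf_act_eq_labFact (i : Fin n) (k : Iface S F.toFactSig)
    (θ : Fin (roleHalf (n := n) i k).nvars → Msg S) :
    ∃ x : Fin k.nvars → Msg S, (roleHalf i k).act.map (Fact.subst θ) = {labFact i k x} := by
  cases k <;> exact ⟨θ, rfl⟩

theorem exists_eq_labFact_of_mEq {i : Fin n} {k : Iface S F.toFactSig} {y : Fin k.nvars → Msg S}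
    {a : Multiset (GFact S (XSig S F.toFactSig n))} (h : MEq E a {labFact i k y}) :
    ∃ x, a = {labFact i k x} := by
  obtain ⟨⟨f, x⟩, m, hb, hm, rfl⟩ := Multiset.rel_cons_right.1 h
  obtain rfl := Multiset.rel_zero_right.1 hm
  obtain rfl : f = .lab i k := hb.sym_eq
  exact ⟨x, rfl⟩

/-- Equality modulo `E` preserves symbols, and original symbols are never synchronization labels. -/
theorem not_mEq_map_baseFact_labFact {i : Fin n} {k : Iface S F.toFactSig}
    {y : Fin k.nvars → Msg S} {a : Multiset (GFact S F.toFactSig)} :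
    ¬ MEq E (a.map (baseFact n)) {labFact i k y} := by
  intro h
  obtain ⟨x, hx⟩ := exists_eq_labFact_of_mEq h
  obtain ⟨g, -, hg⟩ := Multiset.mem_map.1 (hx ▸ Multiset.mem_singleton_self (labFact i k x))
  have := congrArg Fact.sym hg
  cases this

theorem mem_concreteSyncLabels {b : Label S F.toFactSig n A.Carrier} {i : Fin n}
    {k : Iface S F.toFactSig} {x : Fin k.nvars → Msg S} (hk : P.HasIface i k)
    (hb : piExt' A b = some (.perm i k x)) : b ∈ P.concreteSyncLabels E A := by
  refine ⟨{labFact i k x}, by rw [hb]; rfl, {labFact i k x},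
    ⟨i, k, hk, exists_labFact_eq_roleHalf_act i k x⟩, ?_⟩
  exact .refl _

theorem acts_map_baseFact_not_mem_concreteSyncLabels (a : Multiset (GFact S F.toFactSig)) :
    .acts (a.map (baseFact n)) ∉ P.concreteSyncLabels E A := by
  rintro ⟨a', ha, _, ⟨i, k, -, θ, rfl⟩, h⟩
  cases ha
  obtain ⟨x, hx⟩ := exists_roleHalf_act_eq_labFact i k θ
  rw [hx] at h
  exact not_mEq_map_baseFact_labFact h

@[simp] theorem piExt'_cperm (i : Fin n) (k : Iface S F.toFactSig) (x : Fin k.nvars → Msg S) :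
    piExt' A (.cperm i k (fun j => A.γ (x j.val)) x) = some (.perm i k x) :=
  if_pos fun _ => rfl

theorem eq_of_piExt'_cperm {i : Fin n} {k : Iface S F.toFactSig}
    {b : {j : Fin k.nvars // j ≠ k.rid} → A.Carrier} {x : Fin k.nvars → Msg S}
    {ℓ : Label S F.toFactSig n A.Carrier} (h : piExt' A (.cperm i k b x) = some ℓ) :
    ℓ = .perm i k x := by
  by_cases hb : ∀ j, b j = A.γ (x j.val)
  · have h' : piExt' A (.cperm i k b x) = some (.perm i k x) := if_pos hb
    exact Option.some.inj (h.symm.trans h')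
  · have h' : piExt' A (.cperm i k b x) = none := if_neg hb
    exact absurd (h.symm.trans h') (by simp)

theorem LTS.exists_step_of_interleave {L ι : Type} {A : ι → LTS L}
    {s s' : ∀ j, (A j).State} {a : L}
    (h : (LTS.interleave A).step s a s') :
    ∃ j, (A j).step (s j) a (s' j) ∧ ∀ i, i ≠ j → s' i = s i := by
  classical
  obtain ⟨j, t, ht, rfl⟩ := h
  refine ⟨j, ?_, fun i hi => Function.update_of_ne hi _ _⟩
  rwa [Function.update_self]

/-- The system `C` reaches the state `s` with a run whose labels are relabelled to `τ`. -/
def LTS.Reaches {L L' : Type} (C : LTS L) (f : L → L') (τ : List L') (s : C.State) : Prop :=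
  (C.relabel f).Run C.start τ s

/-- A step of the concrete environment is a step of an environment rule of the model or of the
environment half of an interface rule. -/
theorem concreteEnv_step_cases {ok : Multiset (GFact S (XSig S F.toFactSig n)) → Prop}
    {e e' : Multiset (GFact S (XSig S F.toFactSig n))} {b : Label S F.toFactSig n A.Carrier}
    (h : (P.concreteEnv E A ok).step e b e') :
    (∃ R ∈ P.env, ∃ (x : Fin R.nvars → Msg S) (l a r : _), b = .acts a ∧ ok a ∧ R.Sorted x ∧
      (baseRule n R).InstMod E x l a r ∧ Matches l e ∧ e' = update l r e) ∨
    ∃ i k, P.HasIface i k ∧ ∃ (x : Fin k.nvars → Msg S)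
      (y : Fin (envHalf (n := n) i k).nvars → Msg S) (l r : _),
      b = .cperm i k (fun j => A.γ (x j.val)) x ∧ (envHalf i k).Sorted y ∧
      (envHalf i k).InstMod E y l {labFact i k x} r ∧ Matches l e ∧ e' = update l r e := by
  obtain ⟨a, hren, R, hR, x, l, r, hx, hinst, hok, hm, rfl⟩ := h
  rcases hR with ⟨R, hR, -, rfl⟩ | ⟨i, k, hk, rfl⟩
  · cases hren with
    | lab i k y =>
      obtain ⟨a₀, ha₀, -⟩ := exists_map_baseFact_of_mEq hinst.2.1
      have h : MEq E (a₀.map (baseFact n)) {labFact i k y} := ha₀ ▸ .refl _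
      exact absurd h not_mEq_map_baseFact_labFact
    | other a h => exact .inl ⟨R, hR, x, l, a, r, rfl, hok, hx, hinst, hm, rfl⟩
  · obtain ⟨y, hy⟩ := exists_envHalf_act_eq_labFact i k x
    have ha := hinst.2.1
    rw [hy] at ha
    cases hren with
    | lab j k' z =>
      have h := (MEq.of_singleton ha).sym_eq
      obtain ⟨rfl, rfl⟩ := XSym.lab.inj h
      exact .inr ⟨j, k', hk, z, x, l, r, rfl, hx, hinst, hm, rfl⟩
    | other a h =>
      obtain ⟨z, rfl⟩ := exists_eq_labFact_of_mEq ha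
      exact absurd rfl (h i k z)

/-- A program that satisfies the role specification performs only enabled labels. -/
theorem enabled_of_traces_subset {ρ : EqRestr F} {i : Fin n} {rid : S.Fresh}
    {C : LTS (Label S F.toFactSig n A.Carrier)}
    (hC : (C.relabel (piExt' A)).traces ⊆
      (fun τ => τ.map some) '' (P.spec A.Carrier E ρ i rid).traces)
    {u : List (Label S F.toFactSig n A.Carrier)} {s t : C.State}
    (hu : C.Reaches (piExt' A) (u.map some) s)
    {b : Label S F.toFactSig n A.Carrier} (hb : C.step s b t) :
    ∃ ℓ, piExt' A b = some ℓ ∧ P.Enabled E ρ i rid (stateAfter u.reverse) ℓ ∧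
      C.Reaches (piExt' A) ((u ++ [ℓ]).map some) t := by
  have hrun : (C.relabel (piExt' A)).Run C.start (u.map some ++ [piExt' A b]) t :=
    LTS.Run.snoc hu ⟨b, rfl, hb⟩
  obtain ⟨τ, hτ, he⟩ := hC ⟨t, hrun⟩
  obtain ⟨u', v, rfl, hu', hv⟩ := List.map_eq_append_iff.1 he
  obtain ⟨ℓ, v', rfl, hℓ, hv'⟩ := List.map_eq_cons_iff.1 hv
  obtain rfl := List.map_eq_nil_iff.1 hv'
  -- As `some` is injective, the trace obtained for the longer run extends the recorded history `u`.
  obtain rfl : u' = u := List.map_injective_iff.2 (Option.some_injective _) hu'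
  refine ⟨ℓ, hℓ.symm, enabled_of_mem_spec_traces P E ρ i rid hτ, ?_⟩
  rw [List.map_append, List.map_singleton, hℓ]
  exact hrun

/-- An index outside `J` contributes `f z = 0`, so it can join the finite support just when it
moves. -/
theorem sum_update_eq {ι α M : Type*} [DecidableEq ι] [AddCommMonoid M] {f : α → M} {z : α}
    (hf : f z = 0) {u : ι → α} {J : Finset ι} (hJ : ∀ j ∉ J, u j = z) (j : ι) :
    ∃ Y, ∑ i ∈ J, f (u i) = f (u j) + Y ∧
      ∀ v, ∑ i ∈ insert j J, f (Function.update u j v i) = f v + Y := by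
  refine ⟨∑ i ∈ J.erase j, f (u i), ?_, fun v => ?_⟩
  · by_cases hj : j ∈ J
    · exact (Finset.add_sum_erase J (fun i => f (u i)) hj).symm
    · rw [hJ j hj, hf, zero_add, Finset.erase_eq_of_notMem hj]
  · rw [← Finset.add_sum_erase (insert j J) _ (Finset.mem_insert_self j J),
      Finset.erase_insert_eq_erase, Function.update_self]
    congr 1
    refine Finset.sum_congr rfl fun i hi => ?_
    rw [Function.update_of_ne (Finset.ne_of_mem_erase hi)]

open Classical in
/-- The invariant that relates a run `τ` of the concrete system to a run `υ` of the model: `u` are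
the histories of the role instances, only those in `J` have performed a step, and the state `T`
covers the states of all components. -/
def Simulated (P : Protocol S F) (E : EqTheory S) (A : ByteAlg S) (ρ : EqRestr F)
    (ok : Multiset (GFact S (XSig S F.toFactSig n)) → Prop)
    (C : Fin n → S.Fresh → LTS (Label S F.toFactSig n A.Carrier))
    (τ : List (Label S F.toFactSig n A.Carrier))
    (σ : (P.concreteSystem E A ok C).State) : Prop :=
  ∃ (u : Fin n × S.Fresh → List (Label S F.toFactSig n A.Carrier)) (J : Finset (Fin n × S.Fresh))
    (T : Multiset (GFact S F.toFactSig)) (υ : List (Label S F.toFactSig n A.Carrier)),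
    (∀ j : Fin n × S.Fresh, (C j.1 j.2).Reaches (piExt' A) ((u j).map some) (σ.1 j)) ∧
    (∀ j ∉ J, u j = []) ∧
    Covers E T (origin (V := Empty) (F := F.toFactSig) (n := n) σ.2 +
      ∑ j ∈ J, origin (stateAfter (u j).reverse)) ∧
    (P.model E A.Carrier).Run (P.model E A.Carrier).start υ T ∧
    υ.filter (fun ℓ => ℓ ≠ .acts 0) = τ.filter (fun ℓ => ℓ ≠ .acts 0) ∧
    ((∀ a, ok a → ρ.Sat E a) → ∀ a, .acts a ∈ τ → ρ.Sat E a)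

theorem EqRestr.sat_zero (ρ : EqRestr F) :
    ρ.Sat E (0 : Multiset (GFact S (XSig S F.toFactSig n))) :=
  fun _ hg => absurd hg (Multiset.notMem_zero _)

theorem Simulated.step (hP : P.WellFormed) {ρ : EqRestr F}
    {ok : Multiset (GFact S (XSig S F.toFactSig n)) → Prop}
    {C : Fin n → S.Fresh → LTS (Label S F.toFactSig n A.Carrier)}
    (hC : ∀ i rid, ((C i rid).relabel (piExt' A)).traces ⊆
      (fun τ => τ.map some) '' (P.spec A.Carrier E ρ i rid).traces)
    {τ : List (Label S F.toFactSig n A.Carrier)} {σ σ' : (P.concreteSystem E A ok C).State}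
    {ℓ : Label S F.toFactSig n A.Carrier} (h : Simulated P E A ρ ok C τ σ)
    (hstep : (P.concreteSystem E A ok C).step σ ℓ σ') :
    Simulated P E A ρ ok C (τ ++ [ℓ]) σ' := by
  classical
  obtain ⟨u, J, T, υ, hu, hJ, hcov, hrun, hfil, hsat⟩ := h
  obtain ⟨σ, e⟩ := σ
  obtain ⟨σ', e'⟩ := σ'
  have hupd : ∀ (j : Fin n × S.Fresh) (v) (σ₂ : ∀ i : Fin n × S.Fresh, (C i.1 i.2).State),
      (C j.1 j.2).Reaches (piExt' A) (v.map some)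
        (σ₂ j) →
      (∀ i, i ≠ j → σ₂ i = σ i) →
      ∀ i, (C i.1 i.2).Reaches (piExt' A)
        ((Function.update u j v i).map some) (σ₂ i) := by
    intro j v σ₂ hv hne i
    by_cases hij : i = j
    · subst hij
      rwa [Function.update_self]
    · rw [Function.update_of_ne hij, hne i hij]
      exact hu i
  have hJ' : ∀ (j : Fin n × S.Fresh) (v), ∀ i ∉ insert j J, Function.update u j v i = [] := by
    intro j v i hi
    rw [Finset.mem_insert, not_or] at hi
    rw [Function.update_of_ne hi.1, hJ i hi.2]
  rcases hstep with ⟨rfl, b', hb', hrole, henv⟩ | ⟨hℓ, hrole, he⟩ | ⟨hℓ, henv, hσ⟩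
  · obtain ⟨j, ⟨b, rfl, hb⟩, hσ⟩ := LTS.exists_step_of_interleave hrole
    obtain ⟨ℓ, hbℓ, hen, hrun'⟩ := enabled_of_traces_subset (hC j.1 j.2) (hu j) hb
    obtain ⟨Y, hY, hY'⟩ := sum_update_eq (f := fun v : List _ => origin (stateAfter v.reverse))
      (z := []) rfl hJ j
    rcases concreteEnv_step_cases henv with
      ⟨R, hR, x, l, a, r, hba, -, -, hinst, -⟩ | ⟨i, k, hk, x, y, l, r, hbk, hy, hinst, hm, he'⟩
    · obtain ⟨a₀, rfl, -⟩ := exists_map_baseFact_of_mEq hinst.2.1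
      exact absurd (hba ▸ hb') (acts_map_baseFact_not_mem_concreteSyncLabels a₀)
    -- The relabeling `piInt` produces a concrete I/O label only from itself, since internal
    -- operations become multisets of actions.
    · have hb₀ : b = .cperm i k (fun j => A.γ (x j.val)) x := by
        cases b with
        | cperm => exact hbk
        | _ => cases hbk
      obtain rfl : Label.perm i k x = ℓ := by
        rw [hb₀, piExt'_cperm] at hbℓ
        exact Option.some.inj hbℓ
      obtain rfl : i = j.1 := hen.1
      rw [hY] at hcov
      obtain ⟨T', υ', hυ', h0, hc⟩ := hcov.sync_step hP hen hy hinst hm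
      refine ⟨Function.update u j (u j ++ [.perm j.1 k x]), insert j J, T', υ ++ υ',
        hupd j _ _ hrun' hσ, hJ' j _, ?_, hrun.append hυ', ?_, fun hok a ha => ?_⟩
      · rw [hY', List.reverse_append, List.reverse_singleton, List.singleton_append,
          stateAfter_cons]
        rw [← he'] at hc
        exact hc
      · rw [List.filter_append, List.filter_append, hfil]
        congr 1
        rw [List.filter_eq_nil_iff.2 fun ℓ hℓ => by simp [h0 ℓ hℓ]]
        simp
      · rcases List.mem_append.1 ha with ha | ha
        · exact hsat hok a ha
        · cases List.mem_singleton.1 ha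
          exact ρ.sat_zero
  · obtain rfl : e' = e := he
    obtain ⟨j, ⟨b, rfl, hb⟩, hσ⟩ := LTS.exists_step_of_interleave hrole
    obtain ⟨ℓ, hbℓ, hen, hrun'⟩ := enabled_of_traces_subset (hC j.1 j.2) (hu j) hb
    obtain ⟨Y, hY, hY'⟩ := sum_update_eq (f := fun v : List _ => origin (stateAfter v.reverse))
      (z := []) rfl hJ j
    -- A role acting alone can only perform an internal operation: bare action labels are never
    -- enabled, and enabled interface labels lie in the synchronization set.
    cases b with
    | acts a =>
      cases hbℓ
      exact hen.elim
    | perm i k x =>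
      cases hbℓ
      obtain rfl : i = j.1 := hen.1
      exact absurd (mem_concreteSyncLabels (b := .perm j.1 k x) hen.2.1 rfl) hℓ
    | cperm i k b x =>
      obtain rfl := eq_of_piExt'_cperm hbℓ
      obtain rfl : i = j.1 := hen.1
      exact absurd (mem_concreteSyncLabels (b := .cperm j.1 k b x) hen.2.1 hbℓ) hℓ
    | op R x l a r =>
      cases hbℓ
      rw [hY, add_left_comm] at hcov
      obtain ⟨T', hstep, hc⟩ := hcov.role_step hen
      refine ⟨Function.update u j (u j ++ [.op R x l a r]), insert j J, T', υ ++ [.acts a],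
        hupd j _ _ hrun' hσ, hJ' j _, ?_, hrun.snoc hstep, ?_, fun hok a' ha => ?_⟩
      · rw [hY', List.reverse_append, List.reverse_singleton, List.singleton_append,
          stateAfter_cons, add_left_comm]
        exact hc
      · rw [List.filter_append, List.filter_append, hfil]
        rfl
      · rcases List.mem_append.1 ha with ha | ha
        · exact hsat hok a' ha
        -- The restriction is the guard in the specification of the rule, kept as the last component
        -- of `Protocol.Enabled`.
        · cases List.mem_singleton.1 ha
          exact hen.2.2.2.2.2
  · obtain rfl : σ' = σ := hσ
    rcases concreteEnv_step_cases henv with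
      ⟨R, hR, x, l, a, r, rfl, hoka, hx, hinst, hm, he'⟩ | ⟨i, k, hk, x, y, l, r, rfl, -⟩
    · obtain ⟨T', hstep, hc⟩ := hcov.env_step hR hx hinst hm
      refine ⟨u, J, T', υ ++ [.acts a], hu, hJ, ?_, hrun.snoc hstep, ?_, fun hok a' ha => ?_⟩
      · rw [← he'] at hc
        exact hc
      · rw [List.filter_append, List.filter_append, hfil]
      · rcases List.mem_append.1 ha with ha | ha
        · exact hsat hok a' ha
        · cases List.mem_singleton.1 ha
          exact hok _ hoka
    · exact absurd (mem_concreteSyncLabels hk (piExt'_cperm i k x)) hℓ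

theorem simulated_of_run (hP : P.WellFormed) {ρ : EqRestr F}
    {ok : Multiset (GFact S (XSig S F.toFactSig n)) → Prop}
    {C : Fin n → S.Fresh → LTS (Label S F.toFactSig n A.Carrier)}
    (hC : ∀ i rid, ((C i rid).relabel (piExt' A)).traces ⊆
      (fun τ => τ.map some) '' (P.spec A.Carrier E ρ i rid).traces)
    {τ : List (Label S F.toFactSig n A.Carrier)} {σ : (P.concreteSystem E A ok C).State}
    (h : (P.concreteSystem E A ok C).Run (P.concreteSystem E A ok C).start τ σ) :
    Simulated P E A ρ ok C τ σ := by
  refine h.start_induction (motive := Simulated P E A ρ ok C) ?_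
    fun τ s a t hs hstep => hs.step hP hC hstep
  refine ⟨fun _ => [], ∅, 0, [], fun j => .nil _, fun _ _ => rfl, ?_, .nil _, rfl, by simp⟩
  rw [Finset.sum_empty, add_zero]
  exact ⟨⟨0, le_rfl, (linPart_zero (S := S) (F := F.toFactSig)).symm ▸ .refl _⟩,
    fun g hg => absurd hg (Multiset.notMem_zero g)⟩

theorem tamarinTraces_concreteSystem_subset (hP : P.WellFormed) {ρ : EqRestr F}
    {ok : Multiset (GFact S (XSig S F.toFactSig n)) → Prop}
    {C : Fin n → S.Fresh → LTS (Label S F.toFactSig n A.Carrier)}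
    (hC : ∀ i rid, ((C i rid).relabel (piExt' A)).traces ⊆
      (fun τ => τ.map some) '' (P.spec A.Carrier E ρ i rid).traces) :
    tamarinTraces F (P.concreteSystem E A ok C) ⊆ tamarinTraces F (P.model E A.Carrier) := by
  rintro _ ⟨⟨τ, ⟨σ, hσ⟩, rfl⟩, hcf⟩
  obtain ⟨-, -, T, υ, -, -, -, hrun, hfil, -⟩ := simulated_of_run hP hC hσ
  -- The filtered traces are the same list, so collision freeness carries over unchanged.
  exact ⟨⟨υ, ⟨T, hrun⟩, hfil⟩, hcf⟩

theorem tamarinTraces_concreteSystem_subset_traces (hP : P.WellFormed) {ρ : EqRestr F}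
    {C : Fin n → S.Fresh → LTS (Label S F.toFactSig n A.Carrier)}
    (hC : ∀ i rid, ((C i rid).relabel (piExt' A)).traces ⊆
      (fun τ => τ.map some) '' (P.spec A.Carrier E ρ i rid).traces) :
    tamarinTraces F (P.concreteSystem E A (ρ.Sat E) C) ⊆ ρ.traces E A.Carrier := by
  rintro _ ⟨⟨τ, ⟨σ, hσ⟩, rfl⟩, -⟩ a ha
  obtain ⟨-, -, T, υ, -, -, -, -, -, hsat⟩ := simulated_of_run hP hC hσ
  exact hsat (fun _ h => h) a (List.mem_of_mem_filter ha)

end Composition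

end ProtoImpl

theorem theorem2 {n : ℕ} (S : TermSig) (E : EqTheory S) (A : ByteAlg S) (hA : A.Concretizes E)
    (F : ProtoSig n) (ρ : EqRestr F) (P : Protocol S F) (hP : P.WellFormed)
    (Prog : Type*) (sem : Prog → LTS (Label S F.toFactSig n A.Carrier))
    (Verified : (Label S F.toFactSig n A.Carrier → Option (Label S F.toFactSig n A.Carrier)) →
      Assertion S F.toFactSig n A.Carrier → Prog → Prop)
    (hverifier : VerifierAssumption sem Verified)
    (c : Fin n → S.Fresh → Prog)
    (hc : ∀ i rid, Verified (piExt' A) (P.spec A.Carrier E ρ i rid) (c i rid)) :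
    tamarinTraces F (P.concreteSystem E A (fun _ => True) (fun i rid => sem (c i rid))) ⊆
        tamarinTraces F (P.model E A.Carrier) ∧
      tamarinTraces F (P.concreteSystem E A (ρ.Sat E) (fun i rid => sem (c i rid))) ⊆
        tamarinTraces F (P.model E A.Carrier) ∩ ρ.traces E A.Carrier := by

  have hC : ∀ i rid, ((sem (c i rid)).relabel (piExt' A)).traces ⊆
      (fun τ => τ.map some) '' (P.spec A.Carrier E ρ i rid).traces :=
    fun i rid => hverifier _ _ _ (hc i rid)
  exact ⟨tamarinTraces_concreteSystem_subset hP hC, Set.subset_inter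
    (tamarinTraces_concreteSystem_subset hP hC) (tamarinTraces_concreteSystem_subset_traces hP hC)⟩
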